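/- **Setting.** Let $K\ge 1$ arms have reward laws $\nu_1,\dots,\nu_K$ on $\mathbb R$ with distribution functions $F_1,\dots,F_K$; let $X^{(i)}_s$ ($1\le i\le K$, $s\ge 1$) be mutually independent random variables with $X^{(i)}_s\sim\nu_i$. For $x\in\mathbb R$ let $\mathbf 1_x$ be the indicator function of $[x,\infty)$. Let $\hat{\mathcal D}=\{\frac1t\sum_{s\le t}\mathbf 1_{x_s} : t\ge1,\ x_s\in\mathbb R\}$ be the empirical distributions, $\hat F^{(i)}_t=\frac1t\sum_{s\le t}\mathbf 1_{X^{(i)}_s}$, and $\mathcal D^\Delta=\{\sum_i p_iF_i : p_i\ge 0,\ \sum_i p_i=1\}$. Let $L$ be a linear space of bounded functions $\mathbb R\to\mathbb R$ containing every $F_i$ and every $\mathbf 1_x$, with a norm $\|\cdot\|$. For $S\subseteq L$ and $M\ge 0$ let $\hat{\mathcal D}_M(S)=\{f\in\hat{\mathcal D}:\exists F\in S,\ \|F-f\|\le M\}$, and write $\hat{\mathcal D}_M(F)=\hat{\mathcal D}_M(\{F\})$. A map $\hat R:L\to\mathbb R$ is *strongly stable* with constants $b>0$, $q\ge1$, $a>0$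 if (i) $|\hat R(F)-\hat R(G)|\le b(\|F-G\|+\|F-G\|^q)$ for all $F\in\mathcal D^\Delta$, $G\in\mathcal D^\Delta\cup\hat{\mathcal D}$, and (ii) $P(\|\hat F^{(i)}_t-F_i\|\ge x)\le 2e^{-atx^2}$ for all $i$, $x>0$, $t\ge1$. It is *smooth* with constants $d_1,d_2\ge0$, $M_0>0$ if there are bounded linear functionals $A_F$ on $L$ ($F\in L$) such that for every $F\in\mathcal D^\Delta$: $|A_F(G-F)|\le d_1\|G-F\|$ for all $G\in\mathcal D^\Delta\cup\hat{\mathcal D}$, and $|\hat R(G)-\hat R(F)-A_F(G-F)|\le\frac12d_2\|G-F\|^2$ for all $G\in\mathcal D^\Delta\cup\hat{\mathcal D}_{M_0}(F)$. **Statement.** Let $B=(B_1,\dots,B_m):L\to\mathbb R^m$ be linear, let $L$ carry the norm $\|F\|=\max\{\sup_x|F(x)|,\|BF\|_\infty\}$, let $h:\mathbb R^m\to\mathbb R$, $\hat R_h(F)=h(BF)$, and let $\mathcal A_M$ be the convex hull of $\{BF : F\in\mathcal D^\Delta\cup\hat{\mathcal D}_M(\mathcal D^\Delta)\}$. 1.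 *Strong stability.* Suppose there are $b_2>0$, $q_2\ge1$ with $$|h(x)-h(y)|\le b_2\left(\|x-y\|_\infty+\|x-y\|_\infty^{q_2}\right)\qquad\forall x\in\mathcal A_0,\ y\in\mathbb R^m, \tag{1}$$ and $0<a_2\le2$ such that for all $i$, $l$, $x>0$, $t\ge1$ $$P\Big(\Big|\tfrac1t\sum_{s=1}^tB_l(\mathbf 1_{X^{(i)}_s})-B_l(F_i)\Big|>x\Big)\le2e^{-a_2tx^2}. \tag{2}$$ Then $\hat R_h$ is strongly stable with $b=b_2$, $q=q_2$, $a=a_2\frac{\log 2}{\log(2(m+1))}$. 2. *Smoothness.* Suppose $M_0>0$ and $h$ is $C^2$ on $\{x : \mathrm{dist}(x,\mathcal A_{M_0})<\varepsilon\}$ for some $\varepsilon>0$. Then $d_1=\max_{x\in\mathcal A_0}\|\nabla h(x)\|_1$ is attained, $d_2=\sup_{x\in\mathcal A_{M_0}}\|\mathrm{Hess}_x(h)\|_{\infty,1}$ is finite, where $\|W\|_{\infty,1}=\max_{\|v\|_\infty\le1}\|Wv\|_1$, and $\hat R_h$ is smooth with constants $d_1,d_2,M_0$. If moreover (1) holds,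 then $\hat R_h$ is also smooth with constants $d_1',d_2,M_0$, where $d_1'=b_2$ if $q_2>1$, and $d_1'=2b_2$ if $q_2=1$. 3. *Examples.* Suppose $B_lF=\int\varphi_l\,dF$ (with $\varphi_l$ integrable) for every distribution function $F\in L$. In each case "sub-Gaussian" means that (2) holds for some $a_2>0$. (a) Mean-variance: $\varphi=(x,x^2)$, $h(x_1,x_2)=x_1-\rho(x_2-x_1^2)$, $\rho\ge0$. (b) Sharpe ratio: $\varphi=(x,x^2)$, $h=\frac{x_1-r}{\sqrt{\varepsilon_\sigma+x_2-x_1^2}}$, $r\in\mathbb R$, $\varepsilon_\sigma>0$. (c) Sortino ratio: $\varphi=(x,-(x-r)^2\mathbf 1\{x\le r\})$, $h=\frac{x_1-r}{\sqrt{\varepsilon_\sigma-x_2}}$, $r\in\mathbb R$, $\varepsilon_\sigma>0$. In (a), (b), (c), $\hat R_h$ is strongly stable (for some constants $b,q,a$) whenever sub-Gaussianity holds, and for every $M_0>0$ it is smooth with that $M_0$ and some $d_1,d_2$. (d) Entropic risk: $\varphi(x)=e^{-\theta x}$, $h(x)=-\frac1\theta\log x$, $\theta>0$. If sub-Gaussianity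 holds, the concentration requirement (ii) holds for some $a>0$; and for every $0<M_0<\min_i\int e^{-\theta x}\,d\nu_i$ the map $\hat R_h$ is smooth with that $M_0$ and some $d_1,d_2$. -/

import Mathlib

open MeasureTheory ProbabilityTheory
open scoped ENNReal

noncomputable section

namespace EDPM

/-- The space of all bounded functions `ℝ → ℝ`, with the norm `‖f‖ = sup_x |f x|`. -/
abbrev BddFun : Type := lp (fun _ : ℝ => ℝ) ∞

theorem memℓp_of_mem_unit {f : ℝ → ℝ} (h0 : ∀ x, 0 ≤ f x) (h1 : ∀ x, f x ≤ 1) :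
    Memℓp (E := fun _ : ℝ => ℝ) f ∞ := by
  refine memℓp_infty ⟨1, ?_⟩
  rintro _ ⟨x, rfl⟩
  simpa [abs_of_nonneg (h0 x)] using h1 x

/-- The indicator function of `[x, ∞)`, i.e. the distribution function of the constant `x`. -/
def stepFun (x : ℝ) : BddFun :=
  ⟨fun y => (Set.Ici x).indicator (fun _ => (1 : ℝ)) y,
    memℓp_of_mem_unit (fun _ => Set.indicator_nonneg (fun _ _ => zero_le_one) _)
      (fun _ => Set.indicator_le_self' (s := Set.Ici x) (f := fun _ => (1 : ℝ))
        (fun _ _ => zero_le_one) _)⟩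

/-- The cumulative distribution function of a law on the real line. -/
def cdfFun (μ : Measure ℝ) : BddFun :=
  ⟨fun y => cdf μ y, memℓp_of_mem_unit (fun y => cdf_nonneg μ y) (fun y => cdf_le_one μ y)⟩

/-- The reward model: `X i s` is the `(s+1)`-st reward of arm `i`; the rewards of arm `i` have law
`ν i`, and all rewards of all arms are mutually independent. -/
structure IsRewardModel {Ω : Type*} [MeasurableSpace Ω] (P : Measure Ω) {K : ℕ}
    (ν : Fin K → Measure ℝ) (X : Fin K → ℕ → Ω → ℝ) : Prop where
  measurable : ∀ i s, Measurable (X i s)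
  law : ∀ i s, P.map (X i s) = ν i
  indep : iIndepFun (fun p : Fin K × ℕ => X p.1 p.2) P

/-- A linear space of bounded functions containing the distribution functions of the arms and all
empirical distributions. -/
structure FunSpace {K : ℕ} (ν : Fin K → Measure ℝ) where
  space : Submodule ℝ BddFun
  step_mem : ∀ x, stepFun x ∈ space
  arm_mem : ∀ i, cdfFun (ν i) ∈ space

namespace FunSpace

variable {K : ℕ} {ν : Fin K → Measure ℝ} (L : FunSpace ν)

/-- `1_{[x, ∞)}` as an element of the space. -/
def step (x : ℝ) : L.space := ⟨stepFun x, L.step_mem x⟩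

/-- The distribution `F_i` of arm `i`. -/
def arm (i : Fin K) : L.space := ⟨cdfFun (ν i), L.arm_mem i⟩

/-- The empirical distribution of `x_1, …, x_t`. -/
def emp {t : ℕ} (x : Fin t → ℝ) : L.space := (t : ℝ)⁻¹ • ∑ s, L.step (x s)

/-- All empirical distributions of nonempty finite sequences. -/
def empSet : Set L.space := {f | ∃ t : ℕ, 1 ≤ t ∧ ∃ x : Fin t → ℝ, f = L.emp x}

/-- All convex combinations of the arm distributions. -/
def mixSet : Set L.space := {f | ∃ p ∈ stdSimplex ℝ (Fin K), f = ∑ i, p i • L.arm i}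

/-- The empirical distributions at distance at most `M` from some element of `S`. -/
def empBall (N : Seminorm ℝ L.space) (M : ℝ) (S : Set L.space) : Set L.space :=
  {f | f ∈ L.empSet ∧ ∃ F ∈ S, N (F - f) ≤ M}

/-- `R` admits `x ↦ b (x + x ^ q)` as a local modulus of continuity at the mixtures of arms. -/
def HasModulus (N : Seminorm ℝ L.space) (R : L.space → ℝ) (b q : ℝ) : Prop :=
  ∀ F ∈ L.mixSet, ∀ G ∈ L.mixSet ∪ L.empSet, |R F - R G| ≤ b * (N (F - G) + N (F - G) ^ q)

/-- The empirical distribution of each arm concentrates around the distribution of the arm. -/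
def Concentrates {Ω : Type*} [MeasurableSpace Ω] (P : Measure Ω) (X : Fin K → ℕ → Ω → ℝ)
    (N : Seminorm ℝ L.space) (a : ℝ) : Prop :=
  ∀ i : Fin K, ∀ x : ℝ, 0 < x → ∀ t : ℕ, 1 ≤ t →
    P.real {ω | x ≤ N (L.emp (fun s : Fin t => X i s ω) - L.arm i)} ≤ 2 * Real.exp (-a * t * x ^ 2)

/-- `R` is strongly stable, with constants `b`, `q`, `a`. -/
def StronglyStableWith {Ω : Type*} [MeasurableSpace Ω] (P : Measure Ω) (X : Fin K → ℕ → Ω → ℝ)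
    (N : Seminorm ℝ L.space) (R : L.space → ℝ) (b q a : ℝ) : Prop :=
  0 < b ∧ 1 ≤ q ∧ 0 < a ∧ L.HasModulus N R b q ∧ L.Concentrates P X N a

/-- `R` is strongly stable. -/
def StronglyStable {Ω : Type*} [MeasurableSpace Ω] (P : Measure Ω) (X : Fin K → ℕ → Ω → ℝ)
    (N : Seminorm ℝ L.space) (R : L.space → ℝ) : Prop :=
  ∃ b q a : ℝ, L.StronglyStableWith P X N R b q a

/-- `R` is smooth, with constants `d₁`, `d₂`, `M₀`. The map `A` takes values in the linear
functionals on the space that are bounded for the norm `N`. -/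
def SmoothWith (N : Seminorm ℝ L.space) (R : L.space → ℝ) (d₁ d₂ M₀ : ℝ) : Prop :=
  0 ≤ d₁ ∧ 0 ≤ d₂ ∧ 0 < M₀ ∧
    ∃ A : L.space → (L.space →ₗ[ℝ] ℝ),
      (∀ F, ∃ C : ℝ, ∀ f, |A F f| ≤ C * N f) ∧
      ∀ F ∈ L.mixSet,
        (∀ G ∈ L.mixSet ∪ L.empSet, |A F (G - F)| ≤ d₁ * N (G - F)) ∧
        (∀ G ∈ L.mixSet ∪ L.empBall N M₀ {F},
          |R G - R F - A F (G - F)| ≤ 1 / 2 * d₂ * N (G - F) ^ 2)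

variable {m : ℕ} (B : L.space →ₗ[ℝ] (Fin m → ℝ))

/-- The norm `max {sup_x |F x|, ‖B F‖_∞}`. -/
def compNorm : Seminorm ℝ L.space :=
  normSeminorm ℝ L.space ⊔ (normSeminorm ℝ (Fin m → ℝ)).comp B

/-- The convex hull of the image under `B` of the mixtures of arms and of the empirical
distributions at distance at most `M` from them. -/
def hull (M : ℝ) : Set (Fin m → ℝ) :=
  convexHull ℝ (B '' (L.mixSet ∪ L.empBall (L.compNorm B) M L.mixSet))

/-- `h` admits a polynomial local modulus of continuity at the points of the hull. -/
def PolyModulus (h : (Fin m → ℝ) → ℝ) (b q : ℝ) : Prop :=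
  0 < b ∧ 1 ≤ q ∧ ∀ x ∈ L.hull B 0, ∀ y : Fin m → ℝ, |h x - h y| ≤ b * (‖x - y‖ + ‖x - y‖ ^ q)

/-- Each coordinate `B_l (1_{[X, ∞)})` is sub-Gaussian, with constant `a`. -/
def SubGaussianWith {Ω : Type*} [MeasurableSpace Ω] (P : Measure Ω) (X : Fin K → ℕ → Ω → ℝ)
    (a : ℝ) : Prop :=
  ∀ i : Fin K, ∀ l : Fin m, ∀ x : ℝ, 0 < x → ∀ t : ℕ, 1 ≤ t →
    P.real {ω | x < |(t : ℝ)⁻¹ * ∑ s : Fin t, B (L.step (X i s ω)) l - B (L.arm i) l|}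
      ≤ 2 * Real.exp (-a * t * x ^ 2)

/-- `h` is twice continuously differentiable on a neighbourhood of the hull. -/
def C2Near (h : (Fin m → ℝ) → ℝ) (M : ℝ) : Prop :=
  ∃ ε : ℝ, 0 < ε ∧ ContDiffOn ℝ 2 h (Metric.thickening ε (L.hull B M))

/-- `B_l F = ∫ φ_l dF` for every distribution function `F` in the space. -/
def IsMomentMap (φ : Fin m → ℝ → ℝ) : Prop :=
  ∀ f : L.space, ∀ μ : Measure ℝ, IsProbabilityMeasure μ → (f : BddFun) = cdfFun μ →
    ∀ l, Integrable (φ l) μ ∧ B f l = ∫ x, φ l x ∂μ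

end FunSpace

/-- The `ℓ¹` norm of the gradient. -/
def gradNorm {m : ℕ} (h : (Fin m → ℝ) → ℝ) (x : Fin m → ℝ) : ℝ :=
  ∑ j, |fderiv ℝ h x (Pi.single j 1)|

/-- The Hessian matrix. -/
def hessian {m : ℕ} (h : (Fin m → ℝ) → ℝ) (x : Fin m → ℝ) : Matrix (Fin m) (Fin m) ℝ :=
  Matrix.of fun i j => fderiv ℝ (fderiv ℝ h) x (Pi.single i 1) (Pi.single j 1)

/-- The operator norm of a matrix as a map from `ℓ^∞` to `ℓ¹`. -/
def normInfOne {m : ℕ} (W : Matrix (Fin m) (Fin m) ℝ) : ℝ :=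
  sSup ((fun v : Fin m → ℝ => ∑ i, |W.mulVec v i|) '' {v | ‖v‖ ≤ 1})

/-- First and second moment. -/
def momentsTwo : Fin 2 → ℝ → ℝ := ![fun x => x, fun x => x ^ 2]

/-- Mean and negative below-target semi-variance. -/
def momentsTarget (r : ℝ) : Fin 2 → ℝ → ℝ :=
  ![fun x => x, fun x => if x ≤ r then -(x - r) ^ 2 else 0]

/-- Exponential moment. -/
def momentsExp (θ : ℝ) : Fin 1 → ℝ → ℝ := ![fun x => Real.exp (-θ * x)]

/-- Mean-variance, in terms of the mean and the second moment. -/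
def meanVariance (ρ : ℝ) (x : Fin 2 → ℝ) : ℝ := x 0 - ρ * (x 1 - x 0 ^ 2)

/-- The Sharpe ratio, in terms of the mean and the second moment. -/
def sharpe (r ε : ℝ) (x : Fin 2 → ℝ) : ℝ := (x 0 - r) / Real.sqrt (ε + (x 1 - x 0 ^ 2))

/-- The Sortino ratio, in terms of the mean and the negative below-target semi-variance. -/
def sortino (r ε : ℝ) (x : Fin 2 → ℝ) : ℝ := (x 0 - r) / Real.sqrt (ε - x 1)

/-- Entropic risk, in terms of the exponential moment. -/
def entropic (θ : ℝ) (x : Fin 1 → ℝ) : ℝ := -(1 / θ) * Real.log (x 0)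

end EDPM

end

noncomputable section

namespace EDPM

/-! The hard ingredient is the Dvoretzky–Kiefer–Wolfowitz inequality with Massart's constants, `2 *
exp (-2 n ε²)`. It puts the sup norm on the same footing as the `m` coordinates of `B`. A union
bound over `m + 1` events then gives the prefactor `2 (m + 1)`, and comparison with the trivial
bound 1 lowers it to 2, at the price of the factor `log 2 / log (2 (m + 1))` in the exponent.

For a chain of sets `A i`, spread an extra mass `θ` over `A i`. The product of these tilted measures
has total mass `(1 + θ) ^ n` and density `(1 + θ / ν (A i)) ^ (n * freq)`. As the sets shrink, these
densities form a martingale: tilts by two nested sets agree on events that do not look inside the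
larger one (`tilt_map_eq`). Stopping at the largest set whose frequency exceeds its probability by
`ε` bounds the probability of an exceedance by `(1 + θ) ^ n * exp (-n c)`, where `exp (n c)` is a
lower bound for the density there. `exists_tilt` supplies one `θ` for which `c = log (1 + θ) + 2 ε²`
works at all probabilities at once.

The rest is calculus in `ℝ^m`, since `‖B F‖` is at most the norm of `F`. The functional `A_F` is the
derivative of `h` at `B F` composed with `B`, and Taylor's formula is used on segments inside the
convex hull. At radius 0 the hull is the image of a simplex, hence compact, so `d₁` is attained. The
larger hull is only bounded, but its closure stays where `h` is `C²`, so `d₂` is finite. In the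
examples the values of `B` are confined to a closed convex set on which the formula is regular. -/

/-! ### Inequalities for Bernoulli relative entropy -/

theorem log_div_le_of_lt_one {x : ℝ} (h0 : 0 ≤ x) (h1 : x < 1) :
    Real.log ((1 + x) / (1 - x)) ≤ 2 * x / (1 - x ^ 2) := by
  have hy : 0 < (1 + x) / (1 - x) := div_pos (by linarith) (by linarith)
  have hl : 0 ≤ Real.log ((1 + x) / (1 - x)) := by
    apply Real.log_nonneg
    rw [le_div_iff₀ (by linarith)]; linarith
  -- For `y = (1 + x) / (1 - x)`, the right-hand side is `(y - y⁻¹) / 2 = sinh (log y)`.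
  have h := Real.self_le_sinh_iff.2 hl
  rw [Real.sinh_log hy] at h
  refine h.trans (le_of_eq ?_)
  have : (1 - x) ≠ 0 := by linarith
  have : (1 + x) ≠ 0 := by linarith
  have h3 : 1 - x ^ 2 = (1 - x) * (1 + x) := by ring
  rw [h3]
  field_simp
  ring

theorem two_mul_le_log_div {x : ℝ} (h0 : 0 ≤ x) (h1 : x < 1) :
    2 * x ≤ Real.log ((1 + x) / (1 - x)) := by
  have hs := Real.hasSum_log_sub_log_of_abs_lt_one (x := x) (by rwa [abs_of_nonneg h0])
  rw [Real.log_div (by linarith) (by linarith)]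
  have := hs.summable.sum_le_tsum {0} (fun i _ => by positivity)
  rw [hs.tsum_eq] at this
  simpa using this

/-- Pinsker's inequality for Bernoulli laws. -/
theorem two_mul_sq_le_bernoulli_kl {p q : ℝ} (hq : 0 < q) (hqp : q ≤ p) (hp : p < 1) :
    2 * (p - q) ^ 2 ≤ p * Real.log (p / q) + (1 - p) * Real.log ((1 - p) / (1 - q)) := by
  -- Up to a constant this is `kl (p, s) - 2 (p - s)²`, which vanishes at `s = p` and decreases on
  -- `[q, p]` because `4 s (1 - s) ≤ 1`.
  have hd : ∀ s ∈ Set.Icc q p, HasDerivAt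
      (fun s => - p * Real.log s - (1 - p) * Real.log (1 - s) - 2 * (p - s) ^ 2)
      (- p * s⁻¹ - (1 - p) * (-1 / (1 - s)) - 2 * (2 * (p - s) * -1)) s := by
    intro s hs
    have h1 : HasDerivAt (fun s : ℝ => Real.log (1 - s)) (-1 / (1 - s)) s :=
      ((hasDerivAt_id s).const_sub 1).log (by have := hs.2; simp; linarith)
    have h2 : HasDerivAt (fun s : ℝ => (p - s) ^ 2) (2 * (p - s) * -1) s := by
      simpa using ((hasDerivAt_id' s).const_sub p).fun_pow 2
    exact (((Real.hasDerivAt_log (by linarith [hs.1])).const_mul _).sub (h1.const_mul _)).sub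
      (h2.const_mul 2)
  have hanti : AntitoneOn
      (fun s => - p * Real.log s - (1 - p) * Real.log (1 - s) - 2 * (p - s) ^ 2)
      (Set.Icc q p) := by
    refine antitoneOn_of_deriv_nonpos (convex_Icc q p)
      (fun s hs => (hd s hs).continuousAt.continuousWithinAt)
      (fun s hs => (hd s (interior_subset hs)).differentiableAt.differentiableWithinAt) ?_
    intro s hs
    have hs' := interior_subset hs
    rw [(hd s hs').deriv]
    have a1 : 0 < s := by linarith [hs'.1]
    have a2 : 0 < 1 - s := by linarith [hs'.2]
    have : - p * s⁻¹ - (1 - p) * (-1 / (1 - s)) - 2 * (2 * (p - s) * -1)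
        = - ((p - s) * (1 - 2 * s) ^ 2 / (s * (1 - s))) := by
      field_simp; ring
    rw [this]
    have : 0 ≤ p - s := by linarith [hs'.2]
    exact neg_nonpos.2 (by positivity)
  have h := hanti ⟨le_refl q, hqp⟩ ⟨hqp, le_refl p⟩ hqp
  simp only [sub_self] at h
  rw [Real.log_div (by linarith) (by linarith), Real.log_div (by linarith) (by linarith)]
  linarith

/-- A pair of Bernoulli parameters at distance `x` at which `q ↦ kl (q + x, q)` is stationary. -/
theorem exists_stationary {x : ℝ} (h0 : 0 < x) (h1 : x < 1) :
    ∃ q, (1 - x) / 2 ≤ q ∧ q ≤ 1 / 2 ∧ q + x < 1 ∧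
      Real.log ((q + x) * (1 - q) / (q * (1 - (q + x)))) = x / (q * (1 - q)) := by
  -- The stationarity equation, exponentiated and cleared of the denominator `q (1 - (q + x))`, so
  -- that it stays continuous up to `q = 1 - x`.
  set G : ℝ → ℝ := fun q => (q + x) * (1 - q) - q * (1 - (q + x)) * Real.exp (x / (q * (1 - q)))
  set c := min (1 / 2) (1 - x)
  have hac : (1 - x) / 2 ≤ c := le_min (by linarith) (by linarith)
  have hcont : ContinuousOn G (Set.Icc ((1 - x) / 2) c) := by
    refine ContinuousOn.sub (by fun_prop) (ContinuousOn.mul (by fun_prop) (ContinuousOn.rexp ?_))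
    refine ContinuousOn.div (by fun_prop) (by fun_prop) ?_
    intro q hq
    have h2 : q ≤ 1 - x := hq.2.trans (min_le_right _ _)
    exact mul_ne_zero (by linarith [hq.1]) (by linarith)
  have hGa : G ((1 - x) / 2) ≤ 0 := by
    have hl := log_div_le_of_lt_one h0.le h1
    rw [Real.log_le_iff_le_exp (div_pos (by linarith) (by linarith))] at hl
    have h2 : Real.exp (x / ((1 - x) / 2 * (1 - (1 - x) / 2)))
        = Real.exp (2 * x / (1 - x ^ 2)) ^ 2 := by
      rw [← Real.exp_nat_mul]
      congr 1
      have h3 : 1 - x ^ 2 = (1 - x) * (1 + x) := by ring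
      have : (1 - x) ≠ 0 := by linarith
      have : (1 + x) ≠ 0 := by linarith
      have : (1 - (1 - x) / 2) = (1 + x) / 2 := by ring
      rw [h3, this]
      field_simp
      norm_num
    have h3 : ((1 + x) / (1 - x)) ^ 2 ≤ Real.exp (2 * x / (1 - x ^ 2)) ^ 2 :=
      pow_le_pow_left₀ (div_nonneg (by linarith) (by linarith)) hl 2
    rw [div_pow, div_le_iff₀ (by nlinarith)] at h3
    simp only [G, h2]
    nlinarith
  have hGc : 0 ≤ G c := by
    rcases le_total (1 / 2) (1 - x) with h | h
    · have hc : c = 1 / 2 := min_eq_left h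
      rw [hc]
      rcases h.eq_or_lt with h | h
      · have : 1 - (1 / 2 + x) = 0 := by linarith
        simp only [G, this]; norm_num; linarith
      · have hl := two_mul_le_log_div (x := 2 * x) (by linarith) (by linarith)
        rw [Real.le_log_iff_exp_le (div_pos (by linarith) (by linarith)),
          le_div_iff₀ (by linarith)] at hl
        have h2 : x / (1 / 2 * (1 - 1 / 2)) = 2 * (2 * x) := by ring
        simp only [G, h2]
        nlinarith
    · have hc : c = 1 - x := min_eq_right h
      rw [hc]
      have : 1 - (1 - x + x) = 0 := by ring
      simp only [G, this]; norm_num; linarith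
  obtain ⟨q, hq, hGq⟩ := intermediate_value_Icc hac hcont ⟨hGa, hGc⟩
  have q0 : 0 < q := by linarith [hq.1]
  have q1 : q ≤ 1 - x := hq.2.trans (min_le_right _ _)
  have q2 : q + x < 1 := by
    rcases q1.eq_or_lt with h | h
    · exfalso
      have : 1 - (q + x) = 0 := by linarith
      simp only [G, this] at hGq
      have : 0 < (q + x) * (1 - q) := mul_pos (by linarith) (by linarith)
      linarith
    · linarith
  refine ⟨q, hq.1, hq.2.trans (min_le_left _ _), q2, ?_⟩
  have h3 : (q + x) * (1 - q) / (q * (1 - (q + x))) = Real.exp (x / (q * (1 - q))) := by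
    rw [div_eq_iff (mul_ne_zero q0.ne' (by linarith))]
    simp only [G] at hGq
    linarith
  rw [h3, Real.log_exp]

theorem hasDerivAt_log_one_add_div {θ t : ℝ} (hθ : 0 < θ) (ht : 0 < t) :
    HasDerivAt (fun t => Real.log (1 + θ / t)) (-θ / (t * (t + θ))) t := by
  have h1 : HasDerivAt (fun t : ℝ => 1 + θ / t) (θ * (-(t ^ 2)⁻¹)) t := by
    simpa [div_eq_mul_inv] using ((hasDerivAt_inv ht.ne').const_mul θ).const_add 1
  have h2 := h1.log (by positivity)
  convert h2 using 1
  field_simp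

/-- The tilting parameter for which the exponential martingale of an empirical process is large at
every point where the process exceeds the level `x`. -/
theorem exists_tilt {x : ℝ} (h0 : 0 < x) (h1 : x < 1) :
    ∃ θ : ℝ, 0 < θ ∧ ∀ t, 0 < t → t ≤ 1 →
      Real.log (1 + θ) + 2 * x ^ 2 ≤ (t + x) * Real.log (1 + θ / t) := by
  obtain ⟨q, hq, hq2, hqx, hst⟩ := exists_stationary h0 h1
  have q0 : 0 < q := by linarith
  have p1 : 0 < 1 - (q + x) := by linarith
  -- With this `θ`, `(q + θ) / (1 + θ) = q + x`: the normalised tilt carries the success probability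
  -- `q` to `q + x`.
  set θ := x / (1 - (q + x)) with hθ
  have θ0 : 0 < θ := div_pos h0 p1
  have hθe : θ * (1 - (q + x)) = x := div_mul_cancel₀ _ p1.ne'
  have hθ1 : 1 + θ = (1 - q) / (1 - (q + x)) := by
    rw [hθ]; field_simp; ring
  have hθq : 1 + θ / q = (q + x) * (1 - q) / (q * (1 - (q + x))) := by
    rw [hθ]; field_simp; ring
  have hθx : 2 * x ≤ θ := by
    rw [hθ, le_div_iff₀ p1]; nlinarith
  -- The derivative `L` of `f` increases while `t (θ - 2 x) ≤ θ x` and decreases afterwards. It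
  -- vanishes at `q`, which lies in the increasing range because `q ≤ 1 / 2`. So `f` falls until
  -- `q`, rises, and may fall again before 1: its minimum is at `q` or at 1.
  set f : ℝ → ℝ := fun t => (t + x) * Real.log (1 + θ / t) with hf
  set L : ℝ → ℝ := fun t => Real.log (1 + θ / t) - (t + x) * (θ / (t * (t + θ))) with hL
  have hfd : ∀ t, 0 < t → HasDerivAt f (L t) t := by
    intro t ht
    refine (((hasDerivAt_id' t).add_const x).mul
      (hasDerivAt_log_one_add_div θ0 ht)).congr_deriv ?_
    simp only [hL]
    ring
  have hLd : ∀ t, 0 < t → HasDerivAt L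
      (θ * (θ * x - t * (θ - 2 * x)) / (t * (t + θ)) ^ 2) t := by
    intro t ht
    have h2 : HasDerivAt (fun t : ℝ => t * (t + θ)) (1 * (t + θ) + t * 1) t :=
      (hasDerivAt_id' t).mul ((hasDerivAt_id' t).add_const θ)
    have h3 := (hasDerivAt_const t θ).div h2 (by positivity)
    refine ((hasDerivAt_log_one_add_div θ0 ht).sub
      (((hasDerivAt_id' t).add_const x).mul h3)).congr_deriv ?_
    simp only [Pi.div_apply]
    field_simp
    ring
  have hLq : L q = 0 := by
    simp only [hL, hθq, hst]
    have : q + θ = (q + x) * (1 - q) / (1 - (q + x)) := by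
      rw [hθ]; field_simp; ring
    rw [this, hθ]
    have : 1 - q ≠ 0 := by linarith
    have : q + x ≠ 0 := by linarith
    field_simp
    ring
  have hτ : q * (θ - 2 * x) ≤ θ * x := by
    have : q * (θ - 2 * x) - θ * x = θ * ((q + x) * (2 * q - 1)) := by
      linear_combination (2 * q) * hθe
    nlinarith [mul_nonneg θ0.le (mul_nonneg (by linarith : 0 ≤ q + x) (by linarith : 0 ≤ 1 - 2 * q))]
  have hLmono : ∀ s t, 0 < s → s ≤ t → t * (θ - 2 * x) ≤ θ * x → L s ≤ L t := by
    intro s t hs hst ht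
    refine monotoneOn_of_deriv_nonneg (convex_Icc s t)
      (fun u hu => (hLd u (hs.trans_le hu.1)).continuousAt.continuousWithinAt)
      (fun u hu => (hLd u (hs.trans_le (interior_subset hu).1)).differentiableAt.differentiableWithinAt)
      ?_ ⟨le_refl s, hst⟩ ⟨hst, le_refl t⟩ hst
    intro u hu
    have hu' := interior_subset hu
    rw [(hLd u (hs.trans_le hu'.1)).deriv]
    have : u * (θ - 2 * x) ≤ t * (θ - 2 * x) :=
      mul_le_mul_of_nonneg_right hu'.2 (by linarith)
    exact div_nonneg (mul_nonneg θ0.le (by linarith)) (sq_nonneg _)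
  have hLanti : ∀ s t, 0 < s → s ≤ t → θ * x ≤ s * (θ - 2 * x) → L t ≤ L s := by
    intro s t hs hst ht
    refine antitoneOn_of_deriv_nonpos (convex_Icc s t)
      (fun u hu => (hLd u (hs.trans_le hu.1)).continuousAt.continuousWithinAt)
      (fun u hu => (hLd u (hs.trans_le (interior_subset hu).1)).differentiableAt.differentiableWithinAt)
      ?_ ⟨le_refl s, hst⟩ ⟨hst, le_refl t⟩ hst
    intro u hu
    have hu' := interior_subset hu
    rw [(hLd u (hs.trans_le hu'.1)).deriv]
    have : s * (θ - 2 * x) ≤ u * (θ - 2 * x) :=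
      mul_le_mul_of_nonneg_right hu'.1 (by linarith)
    exact div_nonpos_of_nonpos_of_nonneg
      (mul_nonpos_of_nonneg_of_nonpos θ0.le (by linarith)) (sq_nonneg _)
  have hfmono : ∀ s t, 0 < s → s ≤ t → (∀ u ∈ Set.Icc s t, 0 ≤ L u) → f s ≤ f t := by
    intro s t hs hst h
    refine monotoneOn_of_deriv_nonneg (convex_Icc s t)
      (fun u hu => (hfd u (hs.trans_le hu.1)).continuousAt.continuousWithinAt)
      (fun u hu => (hfd u (hs.trans_le (interior_subset hu).1)).differentiableAt.differentiableWithinAt)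
      ?_ ⟨le_refl s, hst⟩ ⟨hst, le_refl t⟩ hst
    intro u hu
    rw [(hfd u (hs.trans_le (interior_subset hu).1)).deriv]
    exact h u (interior_subset hu)
  have hfanti : ∀ s t, 0 < s → s ≤ t → (∀ u ∈ Set.Icc s t, L u ≤ 0) → f t ≤ f s := by
    intro s t hs hst h
    refine antitoneOn_of_deriv_nonpos (convex_Icc s t)
      (fun u hu => (hfd u (hs.trans_le hu.1)).continuousAt.continuousWithinAt)
      (fun u hu => (hfd u (hs.trans_le (interior_subset hu).1)).differentiableAt.differentiableWithinAt)
      ?_ ⟨le_refl s, hst⟩ ⟨hst, le_refl t⟩ hst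
    intro u hu
    rw [(hfd u (hs.trans_le (interior_subset hu).1)).deriv]
    exact h u (interior_subset hu)
  -- Here `f q - log (1 + θ)` is exactly `kl (q + x, q)`, so this is Pinsker's inequality.
  have hfq : Real.log (1 + θ) + 2 * x ^ 2 ≤ f q := by
    have hk := two_mul_sq_le_bernoulli_kl q0 (by linarith : q ≤ q + x) hqx
    have hx : q + x - q = x := by ring
    rw [hx] at hk
    have e1 : (q + x) * (1 - q) / (q * (1 - (q + x)))
        = ((q + x) / q) / ((1 - (q + x)) / (1 - q)) := by
      have : 1 - q ≠ 0 := by linarith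
      field_simp
    have e2 : (1 - q) / (1 - (q + x)) = ((1 - (q + x)) / (1 - q))⁻¹ := by rw [inv_div]
    simp only [hf]
    rw [hθq, hθ1, e1, e2, Real.log_inv, Real.log_div (ne_of_gt (div_pos (by linarith) q0))
      (ne_of_gt (div_pos p1 (by linarith)))]
    linarith
  -- Since `f 1 = (1 + x) log (1 + θ)`, it suffices that `log (1 + θ) ≥ 2 x`. The lower bound `(1 -
  -- x) / 2 ≤ q` serves this purpose.
  have hf1 : Real.log (1 + θ) + 2 * x ^ 2 ≤ f 1 := by
    have h2 : (1 + x) / (1 - x) ≤ 1 + θ := by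
      rw [hθ1, div_le_div_iff₀ (by linarith) p1]; nlinarith
    have h3 := (two_mul_le_log_div h0.le h1).trans
      (Real.log_le_log (div_pos (by linarith) (by linarith)) h2)
    simp only [hf, div_one]
    nlinarith
  refine ⟨θ, θ0, fun t ht ht1 => ?_⟩
  change _ ≤ f t
  rcases le_total t q with htq | htq
  · refine hfq.trans (hfanti t q ht htq fun u hu => ?_)
    rw [← hLq]
    exact hLmono u q (ht.trans_le hu.1) hu.2 hτ
  have hLq' : ∀ u, q ≤ u → u * (θ - 2 * x) ≤ θ * x → 0 ≤ L u := fun u hu hu2 => by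
    rw [← hLq]; exact hLmono q u q0 hu hu2
  rcases le_total (t * (θ - 2 * x)) (θ * x) with h | h
  · exact hfq.trans (hfmono q t q0 htq fun u hu => hLq' u hu.1
      ((mul_le_mul_of_nonneg_right hu.2 (by linarith)).trans h))
  -- Past the peak of `L`, a nonnegative `L t` makes `L` nonnegative on all of `[q, t]`, and a
  -- nonpositive one makes it nonpositive on all of `[t, 1]`.
  rcases le_total 0 (L t) with hLt | hLt
  · refine hfq.trans (hfmono q t q0 htq fun u hu => ?_)
    rcases le_total (u * (θ - 2 * x)) (θ * x) with h | h
    · exact hLq' u hu.1 h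
    · exact hLt.trans (hLanti u t (q0.trans_le hu.1) hu.2 h)
  · exact hf1.trans (hfanti t 1 ht ht1 fun u hu => (hLanti t u ht hu.1 h).trans hLt)

/-! ### A maximal inequality along a chain of sets -/

section Chain

variable {α : Type*} [MeasurableSpace α]

theorem pi_withDensity_eq {n : ℕ} (ν : Measure α) [IsProbabilityMeasure ν] {g : α → ℝ≥0∞}
    (hg : Measurable g) [IsFiniteMeasure (ν.withDensity g)] :
    Measure.pi (fun _ : Fin n => ν.withDensity g)
      = (Measure.pi fun _ : Fin n => ν).withDensity fun x => ∏ s, g (x s) := by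
  refine Measure.pi_eq fun S hS => ?_
  rw [withDensity_apply _ (MeasurableSet.univ_pi hS), Measure.restrict_pi_pi]
  have h1 : ∀ s, ν.withDensity g (S s) = ∫⁻ y, (S s).indicator g y ∂ν := fun s => by
    rw [withDensity_apply _ (hS s), lintegral_indicator (hS s)]
  simp_rw [h1]
  have hind : iIndepFun (fun (s : Fin n) (x : Fin n → α) => (S s).indicator g (x s))
      (Measure.pi fun _ : Fin n => ν) :=
    iIndepFun_pi (μ := fun _ : Fin n => ν) fun s => (hg.indicator (hS s)).aemeasurable
  have h2 := lintegral_prod_eq_prod_lintegral_of_indepFun Finset.univ _ hind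
    fun s => (hg.indicator (hS s)).comp (measurable_pi_apply s)
  have h3 : ∀ s, ∫⁻ x : Fin n → α, (S s).indicator g (x s) ∂(Measure.pi fun _ : Fin n => ν)
      = ∫⁻ y, (S s).indicator g y ∂ν := fun s =>
    (measurePreserving_eval (fun _ : Fin n => ν) s).lintegral_comp (hg.indicator (hS s))
  simp_rw [h3] at h2
  rw [← h2, ← Measure.restrict_pi_pi, ← lintegral_indicator (MeasurableSet.univ_pi hS)]
  refine lintegral_congr fun x => ?_
  by_cases hx : x ∈ Set.univ.pi S
  · rw [Set.indicator_of_mem hx]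
    exact Finset.prod_congr rfl fun s _ => (Set.indicator_of_mem (hx s trivial) _).symm
  · rw [Set.indicator_of_notMem hx]
    simp only [Set.mem_univ_pi, not_forall] at hx
    obtain ⟨s, hs⟩ := hx
    exact (Finset.prod_eq_zero (Finset.mem_univ s) (Set.indicator_of_notMem hs _)).symm

/-- The relative frequency of `A` in a finite sample. -/
def freq {n : ℕ} (A : Set α) (x : Fin n → α) : ℝ :=
  (n : ℝ)⁻¹ * ∑ s, A.indicator (fun _ => (1 : ℝ)) (x s)

theorem measurable_freq {n : ℕ} {A : Set α} (hA : MeasurableSet A) :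
    Measurable (freq (n := n) A) :=
  (Finset.measurable_sum _ fun s _ =>
    (measurable_const.indicator hA).comp (measurable_pi_apply s)).const_mul _

omit [MeasurableSpace α] in
theorem freq_le_one {n : ℕ} (A : Set α) (x : Fin n → α) : freq A x ≤ 1 := by
  have h : ∑ s, A.indicator (fun _ => (1 : ℝ)) (x s) ≤ ∑ _s : Fin n, 1 :=
    Finset.sum_le_sum fun s _ =>
      Set.indicator_le_self' (f := fun _ => (1 : ℝ)) (fun _ _ => zero_le_one) (x s)
  simp only [Finset.sum_const, Finset.card_univ, Fintype.card_fin, nsmul_eq_mul, mul_one] at h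
  rcases n.eq_zero_or_pos with rfl | hn
  · simp [freq]
  · have : (0 : ℝ) < n := by exact_mod_cast hn
    rw [freq, inv_mul_le_iff₀ this]
    linarith

/-- The sum of a measure and `θ` times its conditioning on `A`. -/
def tilt (ν : Measure α) (A : Set α) (θ : ℝ≥0∞) : Measure α := ν + (θ / ν A) • ν.restrict A

theorem tilt_apply (ν : Measure α) (A : Set α) (θ : ℝ≥0∞) {S : Set α} (hS : MeasurableSet S) :
    tilt ν A θ S = ν S + θ / ν A * ν (S ∩ A) := by
  simp [tilt, Measure.restrict_apply hS]

theorem tilt_apply_of_subset (ν : Measure α) [IsFiniteMeasure ν] {A : Set α} (θ : ℝ≥0∞)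
    (hA : ν A ≠ 0) {S : Set α} (hS : MeasurableSet S) (h : A ⊆ S) : tilt ν A θ S = ν S + θ := by
  rw [tilt_apply ν A θ hS, Set.inter_eq_right.2 h, ENNReal.div_mul_cancel hA (measure_ne_top ν A)]

theorem tilt_eq_withDensity (ν : Measure α) {A : Set α} (hA : MeasurableSet A) (θ : ℝ≥0∞) :
    tilt ν A θ = ν.withDensity (fun x => 1 + A.indicator (fun _ => θ / ν A) x) := by
  ext S hS
  rw [tilt_apply ν A θ hS, withDensity_apply _ hS, lintegral_add_left measurable_const,
    lintegral_indicator hA, setLIntegral_const, setLIntegral_const, one_mul,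
    Measure.restrict_apply hA, Set.inter_comm]

theorem isFiniteMeasure_tilt (ν : Measure α) [IsFiniteMeasure ν] {A : Set α} {θ : ℝ≥0∞}
    (hA : ν A ≠ 0) (hθ : θ ≠ ∞) : IsFiniteMeasure (tilt ν A θ) :=
  ⟨by rw [tilt_apply_of_subset ν θ hA .univ (Set.subset_univ _)]
      exact ENNReal.add_lt_top.2 ⟨measure_lt_top _ _, hθ.lt_top⟩⟩

/-- Conditioning on smaller sets is not seen by maps that are constant on the larger set. -/
theorem tilt_map_eq (ν : Measure α) [IsFiniteMeasure ν] {A A' : Set α} {θ : ℝ≥0∞}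
    (hA' : ν A' ≠ 0) (hAA' : A' ⊆ A) {r : α → α} (hr : Measurable r)
    {w : α} (hw : ∀ x ∈ A, r x = w) : (tilt ν A θ).map r = (tilt ν A' θ).map r := by
  have hA : ν A ≠ 0 := fun h => hA' (measure_mono_null hAA' h)
  ext S hS
  rw [Measure.map_apply hr hS, Measure.map_apply hr hS]
  -- The preimage of `S` either contains `A` or misses it. The added mass is `θ` in the first case
  -- and 0 in the second, for `A` and `A'` alike.
  by_cases h : w ∈ S
  · have h1 : A ⊆ r ⁻¹' S := fun x hx => by simpa [hw x hx] using h
    rw [tilt_apply_of_subset ν θ hA (hr hS) h1,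
      tilt_apply_of_subset ν θ hA' (hr hS) (hAA'.trans h1)]
  · have h1 : r ⁻¹' S ∩ A = ∅ := by
      ext x
      simp only [Set.mem_inter_iff, Set.mem_preimage, Set.mem_empty_iff_false, iff_false, not_and]
      exact fun hx hxA => h (hw x hxA ▸ hx)
    have h2 : r ⁻¹' S ∩ A' = ∅ :=
      Set.subset_empty_iff.1 (h1 ▸ Set.inter_subset_inter_right _ hAA')
    rw [tilt_apply ν A θ (hr hS), tilt_apply ν A' θ (hr hS), h1, h2]
    simp

/-- If the frequency of `A` exceeds its probability by `ε`, the density of the tilted product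
measure is large. -/
theorem mul_pi_le_pi_tilt {n : ℕ} (ν : Measure α) [IsProbabilityMeasure ν] {A : Set α}
    (hA : MeasurableSet A) (hA0 : ν A ≠ 0) {θ ε : ℝ} (hθ : 0 < θ) {c : ℝ}
    (hc : c ≤ (ν.real A + ε) * Real.log (1 + θ / ν.real A))
    {E : Set (Fin n → α)} (hE : MeasurableSet E) (hEA : ∀ x ∈ E, ν.real A + ε ≤ freq A x) :
    ENNReal.ofReal (Real.exp (n * c)) * Measure.pi (fun _ : Fin n => ν) E
      ≤ Measure.pi (fun _ : Fin n => tilt ν A (ENNReal.ofReal θ)) E := by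
  have hp : 0 < ν.real A := ENNReal.toReal_pos hA0 (measure_ne_top _ _)
  have hfin := isFiniteMeasure_tilt ν hA0 (ENNReal.ofReal_ne_top (r := θ))
  have hg : Measurable fun x => 1 + A.indicator (fun _ => ENNReal.ofReal θ / ν A) x :=
    (measurable_const.indicator hA).const_add _
  rw [tilt_eq_withDensity ν hA] at hfin ⊢
  rw [pi_withDensity_eq ν hg, withDensity_apply _ hE, ← setLIntegral_const]
  refine setLIntegral_mono' hE fun x hx => ?_
  have hl : 0 ≤ Real.log (1 + θ / ν.real A) :=
    Real.log_nonneg (by have := div_pos hθ hp; linarith)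
  have h1 : ∀ y, 1 + A.indicator (fun _ => ENNReal.ofReal θ / ν A) y
      = ENNReal.ofReal (Real.exp (Real.log (1 + θ / ν.real A) * A.indicator (fun _ => 1) y)) := by
    intro y
    by_cases hy : y ∈ A
    · rw [Set.indicator_of_mem hy, Set.indicator_of_mem hy, mul_one, Real.exp_log (by positivity),
        ENNReal.ofReal_add zero_le_one (by positivity), ENNReal.ofReal_one,
        ENNReal.ofReal_div_of_pos hp, measureReal_def, ENNReal.ofReal_toReal (measure_ne_top _ _)]
    · simp [hy]
  simp_rw [h1]
  rw [← ENNReal.ofReal_prod_of_nonneg fun _ _ => (Real.exp_pos _).le, ← Real.exp_sum,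
    ← Finset.mul_sum]
  refine ENNReal.ofReal_le_ofReal (Real.exp_le_exp.2 ?_)
  have h2 := hEA x hx
  rcases n.eq_zero_or_pos with rfl | hn
  · simp
  have hn' : (0 : ℝ) < n := by exact_mod_cast hn
  rw [freq, le_inv_mul_iff₀ hn'] at h2
  calc (n : ℝ) * c ≤ n * ((ν.real A + ε) * Real.log (1 + θ / ν.real A)) :=
        mul_le_mul_of_nonneg_left hc hn'.le
    _ = Real.log (1 + θ / ν.real A) * (n * (ν.real A + ε)) := by ring
    _ ≤ _ := mul_le_mul_of_nonneg_left h2 hl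

variable {ι : Type*} [LinearOrder ι]

/-- A maximal inequality for the exponential martingale of the frequencies along a chain. -/
theorem mul_pi_exists_le_pi_tilt {n : ℕ} (ν : Measure α) [IsProbabilityMeasure ν] {A : ι → Set α}
    (hA : ∀ i, MeasurableSet (A i)) (hmono : Monotone A) (hA0 : ∀ i, ν (A i) ≠ 0)
    {θ ε : ℝ} (hθ : 0 < θ) {c : ℝ}
    (hc : ∀ i, c ≤ (ν.real (A i) + ε) * Real.log (1 + θ / ν.real (A i))) (I : Finset ι) :
    ∀ j, (∀ i ∈ I, j ≤ i) →
    ENNReal.ofReal (Real.exp (n * c)) * Measure.pi (fun _ : Fin n => ν)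
        {x | ∃ i ∈ I, ν.real (A i) + ε ≤ freq (A i) x}
      ≤ Measure.pi (fun _ : Fin n => tilt ν (A j) (ENNReal.ofReal θ))
        {x | ∃ i ∈ I, ν.real (A i) + ε ≤ freq (A i) x} := by
  have hfin := fun i => isFiniteMeasure_tilt ν (hA0 i) (ENNReal.ofReal_ne_top (r := θ))
  have hmeas : ∀ I : Finset ι, MeasurableSet
      {x : Fin n → α | ∃ i ∈ I, ν.real (A i) + ε ≤ freq (A i) x} := by
    intro I
    have : {x : Fin n → α | ∃ i ∈ I, ν.real (A i) + ε ≤ freq (A i) x}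
        = ⋃ i ∈ I, {x | ν.real (A i) + ε ≤ freq (A i) x} := by ext; simp
    rw [this]
    exact Finset.measurableSet_biUnion _ fun i _ =>
      measurableSet_le measurable_const (measurable_freq (hA i))
  -- Optional stopping, with the sets taken from the largest down. The bound is proved for every
  -- lower index `j` so that the induction hypothesis can be used at the new minimum `a`. On `H' \
  -- H` the only exceedance is at `a`, where the density of that same tilt is large.
  induction I using Finset.induction_on_min with
  | empty => simp
  | insert a I haI ih =>
    intro j hj
    have hja : j ≤ a := hj a (Finset.mem_insert_self a I)
    set H := {x : Fin n → α | ∃ i ∈ I, ν.real (A i) + ε ≤ freq (A i) x}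
    set H' := {x : Fin n → α | ∃ i ∈ insert a I, ν.real (A i) + ε ≤ freq (A i) x}
    have hHH' : H ⊆ H' := fun x ⟨i, hi, h⟩ => ⟨i, Finset.mem_insert_of_mem hi, h⟩
    have h1 := ih a fun i hi => (haI i hi).le
    have h2 : ENNReal.ofReal (Real.exp (n * c)) * Measure.pi (fun _ : Fin n => ν) (H' \ H)
        ≤ Measure.pi (fun _ : Fin n => tilt ν (A a) (ENNReal.ofReal θ)) (H' \ H) := by
      refine mul_pi_le_pi_tilt ν (hA a) (hA0 a) hθ (hc a) ((hmeas _).diff (hmeas _)) ?_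
      rintro x ⟨⟨i, hi, hx⟩, hxH⟩
      rcases Finset.mem_insert.1 hi with rfl | hi
      · exact hx
      · exact absurd ⟨i, hi, hx⟩ hxH
    have h3 : ENNReal.ofReal (Real.exp (n * c)) * Measure.pi (fun _ : Fin n => ν) H'
        ≤ Measure.pi (fun _ : Fin n => tilt ν (A a) (ENNReal.ofReal θ)) H' := by
      have hU : H' = H ∪ H' \ H := (Set.union_sdiff_cancel hHH').symm
      rw [hU, measure_union Set.disjoint_sdiff_right ((hmeas _).diff (hmeas _)),
        measure_union Set.disjoint_sdiff_right ((hmeas _).diff (hmeas _)), mul_add]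
      exact add_le_add h1 h2
    refine h3.trans (le_of_eq ?_)
    -- To pass from `a` to `j`, collapse `A a` to one of its points. Each `A i` with `a ≤ i`
    -- contains `A a`, so `H'` is invariant under the collapse, which also erases the difference
    -- between the two tilts.
    obtain ⟨w, hw⟩ : (A a).Nonempty := nonempty_of_measure_ne_zero (hA0 a)
    classical
    set r : α → α := (A a).piecewise (fun _ => w) id
    have hr : Measurable r := Measurable.piecewise (hA a) measurable_const measurable_id
    have hrw : ∀ x ∈ A a, r x = w := fun x hx => Set.piecewise_eq_of_mem _ _ _ hx
    have hrA : ∀ i, a ≤ i → ∀ x, r x ∈ A i ↔ x ∈ A i := by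
      intro i hi x
      by_cases hx : x ∈ A a
      · rw [hrw x hx]
        exact iff_of_true (hmono hi hw) (hmono hi hx)
      · rw [show r x = x from Set.piecewise_eq_of_notMem _ _ _ hx]
    have hpre : (fun (x : Fin n → α) s => r (x s)) ⁻¹' H' = H' := by
      ext x
      refine exists_congr fun i => and_congr_right fun hi => ?_
      have hai : a ≤ i := by
        rcases Finset.mem_insert.1 hi with rfl | hi
        · exact le_rfl
        · exact (haI i hi).le
      have : freq (A i) (fun s => r (x s)) = freq (A i) x := by
        simp only [freq, Set.indicator, hrA i hai]
      rw [this]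
    have hrm : Measurable (fun (x : Fin n → α) s => r (x s)) :=
      measurable_pi_lambda _ fun s => hr.comp (measurable_pi_apply s)
    have key : ∀ i, Measure.pi (fun _ : Fin n => tilt ν (A i) (ENNReal.ofReal θ)) H'
        = Measure.pi (fun _ : Fin n => (tilt ν (A i) (ENNReal.ofReal θ)).map r) H' := by
      intro i
      rw [← Measure.pi_map_pi (fun _ => hr.aemeasurable), Measure.map_apply hrm (hmeas _), hpre]
    rw [key a, key j, tilt_map_eq ν (hA0 j) (hmono hja) hr hrw]

/-- One-sided Dvoretzky–Kiefer–Wolfowitz–Massart inequality for a chain of sets of positive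
probability. -/
theorem pi_exists_freq_le_of_pos [Countable ι] {n : ℕ} (ν : Measure α) [IsProbabilityMeasure ν]
    {A : ι → Set α} (hA : ∀ i, MeasurableSet (A i)) (hmono : Monotone A) (hA0 : ∀ i, ν (A i) ≠ 0)
    {ε : ℝ} (hε : 0 < ε) :
    Measure.pi (fun _ : Fin n => ν) {x | ∃ i, ν.real (A i) + ε ≤ freq (A i) x}
      ≤ ENNReal.ofReal (Real.exp (-2 * n * ε ^ 2)) := by
  have hp : ∀ i, 0 < ν.real (A i) := fun i => ENNReal.toReal_pos (hA0 i) (measure_ne_top _ _)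
  rcases le_or_gt 1 ε with h1 | h1
  · have : {x : Fin n → α | ∃ i, ν.real (A i) + ε ≤ freq (A i) x} = ∅ := by
      ext x
      simp only [Set.mem_ofPred_eq, Set.mem_empty_iff_false, iff_false, not_exists, not_le]
      intro i
      linarith [freq_le_one (A i) x, hp i]
    simp [this]
  obtain ⟨θ, hθ, ht⟩ := exists_tilt hε h1
  have hc : ∀ i, Real.log (1 + θ) + 2 * ε ^ 2
      ≤ (ν.real (A i) + ε) * Real.log (1 + θ / ν.real (A i)) :=
    fun i => ht _ (hp i) measureReal_le_one
  have hU : {x : Fin n → α | ∃ i, ν.real (A i) + ε ≤ freq (A i) x}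
      = ⋃ I : Finset ι, {x | ∃ i ∈ I, ν.real (A i) + ε ≤ freq (A i) x} := by
    ext x
    simp only [Set.mem_ofPred_eq, Set.mem_iUnion]
    exact ⟨fun ⟨i, hi⟩ => ⟨{i}, i, Finset.mem_singleton_self i, hi⟩, fun ⟨_, i, _, hi⟩ => ⟨i, hi⟩⟩
  have hm : Monotone fun I : Finset ι =>
      {x : Fin n → α | ∃ i ∈ I, ν.real (A i) + ε ≤ freq (A i) x} :=
    fun I J hIJ x ⟨i, hi, hx⟩ => ⟨i, hIJ hi, hx⟩
  rw [hU, hm.directed_le.measure_iUnion]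
  refine iSup_le fun I => ?_
  rcases I.eq_empty_or_nonempty with rfl | hI
  · simp
  have h2 := mul_pi_exists_le_pi_tilt (n := n) ν hA hmono hA0 hθ hc I (I.min' hI)
    fun i hi => I.min'_le i hi
  have hfin := isFiniteMeasure_tilt ν (hA0 (I.min' hI)) (ENNReal.ofReal_ne_top (r := θ))
  have h3 : Measure.pi (fun _ : Fin n => tilt ν (A (I.min' hI)) (ENNReal.ofReal θ)) Set.univ
      = ENNReal.ofReal (Real.exp (n * Real.log (1 + θ))) := by
    rw [Measure.pi_univ, tilt_apply_of_subset ν _ (hA0 _) .univ (Set.subset_univ _), measure_univ,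
      Finset.prod_const, Finset.card_univ, Fintype.card_fin, Real.exp_nat_mul,
      Real.exp_log (by linarith), ENNReal.ofReal_pow (by linarith),
      ENNReal.ofReal_add zero_le_one hθ.le, ENNReal.ofReal_one]
  have h4 := h2.trans ((measure_mono (Set.subset_univ _)).trans h3.le)
  have h5 : ENNReal.ofReal (Real.exp (n * (Real.log (1 + θ) + 2 * ε ^ 2))) ≠ 0 := by
    simpa using Real.exp_pos _
  refine (ENNReal.mul_le_mul_iff_right h5 ENNReal.ofReal_ne_top).1 (h4.trans_eq ?_)
  rw [← ENNReal.ofReal_mul (Real.exp_pos _).le, ← Real.exp_add]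
  congr 2
  ring

end Chain

/-- One-sided Dvoretzky–Kiefer–Wolfowitz–Massart inequality for a countable chain of sets. -/
theorem pi_exists_freq_le {α ι : Type*} [MeasurableSpace α] [LinearOrder ι] [Countable ι] {n : ℕ}
    (ν : Measure α) [IsProbabilityMeasure ν] {A : ι → Set α} (hA : ∀ i, MeasurableSet (A i))
    (hmono : Monotone A) {ε : ℝ} (hε : 0 < ε) :
    Measure.pi (fun _ : Fin n => ν) {x | ∃ i, ν.real (A i) + ε ≤ freq (A i) x}
      ≤ ENNReal.ofReal (Real.exp (-2 * n * ε ^ 2)) := by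
  have h1 := pi_exists_freq_le_of_pos (n := n) ν (A := fun i : {i // ν (A i) ≠ 0} => A i)
    (fun i => hA i) (fun i j hij => hmono hij) (fun i => i.2) hε
  -- Almost surely no sample point falls in any of the countably many null sets, so these produce no
  -- exceedance.
  have h2 : ∀ᵐ x ∂(Measure.pi fun _ : Fin n => ν), ∀ i, ν (A i) = 0 → ∀ s, x s ∉ A i := by
    refine ae_all_iff.2 fun i => ?_
    by_cases hi : ν (A i) = 0
    · have : ∀ s, ∀ᵐ x ∂(Measure.pi fun _ : Fin n => ν), x s ∉ A i := fun s =>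
        (Measure.tendsto_eval_ae_ae (μ := fun _ : Fin n => ν) (i := s)).eventually
          (measure_eq_zero_iff_ae_notMem.1 hi)
      filter_upwards [ae_all_iff.2 this] with x hx _ using hx
    · exact ae_of_all _ fun x h => absurd h hi
  refine (measure_mono_ae ?_).trans h1
  filter_upwards [h2] with x hx h
  obtain ⟨i, hi⟩ := h
  by_cases h0 : ν (A i) = 0
  · exfalso
    have : freq (A i) x = 0 := by simp [freq, Set.indicator, hx i h0]
    rw [this, measureReal_def, h0] at hi
    simp at hi
    linarith
  · exact ⟨⟨i, h0⟩, hi⟩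

/-! ### From chains of sets to distribution functions -/

theorem freq_compl {α : Type*} {n : ℕ} (hn : 0 < n) (A : Set α) (x : Fin n → α) :
    freq Aᶜ x = 1 - freq A x := by
  have hn' : (n : ℝ) ≠ 0 := by positivity
  have h : ∀ y, Aᶜ.indicator (fun _ => (1 : ℝ)) y = 1 - A.indicator (fun _ => 1) y := fun y => by
    by_cases hy : y ∈ A <;> simp [hy]
  simp only [freq, h, Finset.sum_sub_distrib, Finset.sum_const, Finset.card_univ, Fintype.card_fin,
    nsmul_eq_mul, mul_one, mul_sub, inv_mul_cancel₀ hn']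

theorem exists_rat_lt_abs_freq_sub_cdf {n : ℕ} (ν : Measure ℝ) (x : Fin n → ℝ) {ε y : ℝ}
    (h : ε < |freq (Set.Iic y) x - cdf ν y|) :
    ∃ q : ℚ, ε < |freq (Set.Iic (q : ℝ)) x - cdf ν q| := by
  -- Just to the right of `y` the frequency no longer changes, and the distribution function is
  -- right continuous, so the strict inequality persists at a nearby rational.
  have h1 : ∀ s, ∀ᶠ z in nhdsWithin y (Set.Ioi y), (x s ∈ Set.Iic z ↔ x s ∈ Set.Iic y) := by
    intro s
    rcases le_or_gt (x s) y with hs | hs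
    · filter_upwards [self_mem_nhdsWithin] with z hz
      exact iff_of_true (hs.trans (le_of_lt hz)) hs
    · filter_upwards [Ioo_mem_nhdsGT hs] with z hz
      exact iff_of_false (not_le.2 hz.2) (not_le.2 hs)
  have h2 : Filter.Tendsto (cdf ν) (nhdsWithin y (Set.Ioi y)) (nhds (cdf ν y)) :=
    ((cdf ν).right_continuous y).mono Set.Ioi_subset_Ici_self
  have h3 := ((h2.const_sub (freq (Set.Iic y) x)).abs).eventually (lt_mem_nhds h)
  have h4 := (Filter.eventually_all.2 h1).and h3
  obtain ⟨u, hu, hsub⟩ := mem_nhdsGT_iff_exists_Ioo_subset.1 h4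
  obtain ⟨q, hyq, hqu⟩ := exists_rat_btwn (show y < u from hu)
  obtain ⟨h5, h6⟩ := hsub ⟨hyq, hqu⟩
  refine ⟨q, ?_⟩
  have : freq (Set.Iic (q : ℝ)) x = freq (Set.Iic y) x := by
    simp only [freq, Set.indicator, h5]
  rwa [this]

/-- The Dvoretzky–Kiefer–Wolfowitz–Massart inequality. -/
theorem pi_exists_lt_abs_freq_sub_cdf_le {n : ℕ} (hn : 0 < n) (ν : Measure ℝ)
    [IsProbabilityMeasure ν] {ε : ℝ} (hε : 0 < ε) :
    Measure.pi (fun _ : Fin n => ν) {x | ∃ y, ε < |freq (Set.Iic y) x - cdf ν y|}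
      ≤ ENNReal.ofReal (2 * Real.exp (-2 * n * ε ^ 2)) := by
  have h1 := pi_exists_freq_le (n := n) ν (A := fun q : ℚ => Set.Iic (q : ℝ))
    (fun _ => measurableSet_Iic) (fun a b hab => Set.Iic_subset_Iic.2 (by exact_mod_cast hab)) hε
  -- Lower deviations are upper deviations of the complements, which form a chain for the reversed
  -- order.
  have : Countable ℚᵒᵈ := inferInstanceAs (Countable ℚ)
  have h2 := pi_exists_freq_le (n := n) ν
    (A := fun q : ℚᵒᵈ => (Set.Iic ((OrderDual.ofDual q : ℚ) : ℝ))ᶜ)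
    (fun _ => measurableSet_Iic.compl)
    (fun a b hab => Set.compl_subset_compl.2 (Set.Iic_subset_Iic.2
      (by exact_mod_cast (OrderDual.ofDual_le_ofDual.2 hab)))) hε
  rw [two_mul, ENNReal.ofReal_add (Real.exp_pos _).le (Real.exp_pos _).le]
  refine (measure_mono ?_).trans ((measure_union_le _ _).trans (add_le_add h1 h2))
  rintro x ⟨y, hy⟩
  obtain ⟨q, hq⟩ := exists_rat_lt_abs_freq_sub_cdf ν x hy
  rw [cdf_eq_real] at hq
  rcases lt_abs.1 hq with h | h
  · exact Or.inl ⟨q, by linarith⟩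
  · refine Or.inr ⟨OrderDual.toDual q, ?_⟩
    rw [freq_compl hn, OrderDual.ofDual_toDual, probReal_compl_eq_one_sub measurableSet_Iic]
    linarith

/-! ### Concentration of the empirical distributions -/

theorem IsRewardModel.map_eq_pi {Ω : Type*} [MeasurableSpace Ω] {P : Measure Ω} {K : ℕ}
    {ν : Fin K → Measure ℝ} {X : Fin K → ℕ → Ω → ℝ} [IsProbabilityMeasure P] (hX : IsRewardModel P ν X) (i : Fin K)
    (t : ℕ) : P.map (fun ω (s : Fin t) => X i s ω) = Measure.pi fun _ : Fin t => ν i := by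
  have h1 : iIndepFun (fun s : Fin t => X i s) P :=
    hX.indep.precomp (g := fun s : Fin t => (i, (s : ℕ))) fun s s' h => by
      simpa [Fin.ext_iff] using h
  rw [(iIndepFun_iff_map_fun_eq_pi_map
    fun s : Fin t => (hX.measurable i s).aemeasurable).1 h1]
  simp_rw [hX.law]

namespace FunSpace

variable {Ω : Type*} [MeasurableSpace Ω] {P : Measure Ω} {K : ℕ} {ν : Fin K → Measure ℝ}
  {X : Fin K → ℕ → Ω → ℝ} (L : FunSpace ν)

theorem emp_apply {t : ℕ} (x : Fin t → ℝ) (y : ℝ) :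
    ((L.emp x : L.space) : BddFun) y = freq (Set.Iic y) x := by
  have h : ((L.emp x : L.space) : BddFun) = (t : ℝ)⁻¹ • ∑ s, stepFun (x s) := by
    simp [emp, step]
  rw [h, lp.coeFn_smul, Pi.smul_apply, lp.coeFn_sum, Finset.sum_apply]
  rfl

theorem exists_lt_abs_of_lt_norm {f : L.space} {ε : ℝ} (hε : 0 ≤ ε) (h : ε < ‖f‖) :
    ∃ y, ε < |(f : BddFun) y| := by
  by_contra! hc
  exact not_le.2 h (lp.norm_le_of_forall_le hε hc)

theorem real_lt_norm_le [IsProbabilityMeasure P] [∀ i, IsProbabilityMeasure (ν i)]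
    (hX : IsRewardModel P ν X) (i : Fin K) {t : ℕ} (ht : 1 ≤ t) {ε : ℝ} (hε : 0 < ε) :
    P.real {ω | ε < ‖L.emp (fun s : Fin t => X i s ω) - L.arm i‖}
      ≤ 2 * Real.exp (-2 * t * ε ^ 2) := by
  have h1 := pi_exists_lt_abs_freq_sub_cdf_le ht (ν i) hε
  rw [← hX.map_eq_pi i t] at h1
  refine ENNReal.toReal_le_of_le_ofReal (by positivity) (((measure_mono ?_).trans
    (Measure.le_map_apply (measurable_pi_lambda _ fun s : Fin t => hX.measurable i s).aemeasurable
      _)).trans h1)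
  intro ω hω
  obtain ⟨y, hy⟩ := L.exists_lt_abs_of_lt_norm hε.le hω
  refine ⟨y, ?_⟩
  rw [← L.emp_apply]
  exact hy

end FunSpace

/-- With `k = log 2 / log c ≤ 1`, the logarithm of the right-hand side is `k (log c - y)`. This is
nonnegative for `y ≤ log c`, and at least `log c - y` otherwise. -/
theorem min_one_mul_exp_le {c y : ℝ} (hc : 2 ≤ c) :
    min 1 (c * Real.exp (-y)) ≤ 2 * Real.exp (-(Real.log 2 / Real.log c * y)) := by
  have h2 : 0 < Real.log 2 := Real.log_pos one_lt_two
  have hl : Real.log 2 ≤ Real.log c := Real.log_le_log two_pos hc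
  have hc0 : 0 < Real.log c := h2.trans_le hl
  set k := Real.log 2 / Real.log c with hk
  have hk1 : k ≤ 1 := (div_le_one hc0).2 hl
  have hk0 : 0 < k := div_pos h2 hc0
  have hkc : k * Real.log c = Real.log 2 := div_mul_cancel₀ _ hc0.ne'
  have e2 : 2 * Real.exp (-(k * y)) = Real.exp (Real.log 2 - k * y) := by
    rw [sub_eq_add_neg, Real.exp_add, Real.exp_log two_pos]
  rw [e2]
  rcases le_total y (Real.log c) with h | h
  · refine (min_le_left _ _).trans (Real.one_le_exp ?_)
    nlinarith
  · refine (min_le_right _ _).trans ?_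
    have e1 : c * Real.exp (-y) = Real.exp (Real.log c - y) := by
      rw [sub_eq_add_neg, Real.exp_add, Real.exp_log (by linarith)]
    rw [e1]
    refine Real.exp_le_exp.2 ?_
    nlinarith

namespace FunSpace

variable {Ω : Type*} [MeasurableSpace Ω] {P : Measure Ω} {K : ℕ} {ν : Fin K → Measure ℝ}
  {X : Fin K → ℕ → Ω → ℝ} (L : FunSpace ν) {m : ℕ} (B : L.space →ₗ[ℝ] (Fin m → ℝ))

theorem norm_le_compNorm (f : L.space) : ‖f‖ ≤ L.compNorm B f := le_max_left _ _

theorem norm_map_le_compNorm (f : L.space) : ‖B f‖ ≤ L.compNorm B f := le_max_right _ _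

theorem map_emp {t : ℕ} (x : Fin t → ℝ) :
    B (L.emp x) = (t : ℝ)⁻¹ • ∑ s, B (L.step (x s)) := by
  simp [emp]

theorem SubGaussianWith.mono {L : FunSpace ν} {B : L.space →ₗ[ℝ] (Fin m → ℝ)} {a a' : ℝ}
    (h : L.SubGaussianWith B P X a) (ha : a' ≤ a) : L.SubGaussianWith B P X a' := by
  intro i l x hx t ht
  refine (h i l x hx t ht).trans ?_
  have : a' * (t * x ^ 2) ≤ a * (t * x ^ 2) := mul_le_mul_of_nonneg_right ha (by positivity)
  have : Real.exp (-a * t * x ^ 2) ≤ Real.exp (-a' * t * x ^ 2) :=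
    Real.exp_le_exp.2 (by linarith)
  linarith

theorem real_lt_compNorm_le [IsProbabilityMeasure P] [∀ i, IsProbabilityMeasure (ν i)]
    (hX : IsRewardModel P ν X) {a : ℝ} (ha2 : a ≤ 2)
    (h : L.SubGaussianWith B P X a) (i : Fin K) {x : ℝ} (hx : 0 < x) {t : ℕ} (ht : 1 ≤ t) :
    P.real {ω | x < L.compNorm B (L.emp (fun s : Fin t => X i s ω) - L.arm i)}
      ≤ 2 * (m + 1) * Real.exp (-(a * t * x ^ 2)) := by
  have hsub : {ω | x < L.compNorm B (L.emp (fun s : Fin t => X i s ω) - L.arm i)}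
      ⊆ {ω | x < ‖L.emp (fun s : Fin t => X i s ω) - L.arm i‖} ∪
        ⋃ l : Fin m, {ω | x < |(t : ℝ)⁻¹ * ∑ s : Fin t, B (L.step (X i s ω)) l
          - B (L.arm i) l|} := by
    intro ω hω
    rcases lt_max_iff.1 (show x < max _ _ from hω) with h1 | h1
    · exact Or.inl h1
    · right
      by_contra! hc
      simp only [Set.mem_iUnion, not_exists] at hc
      refine not_le.2 h1 ((pi_norm_le_iff_of_nonneg hx.le).2 fun l => ?_)
      rw [map_sub, Pi.sub_apply, map_emp, Pi.smul_apply, Finset.sum_apply, smul_eq_mul,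
        Real.norm_eq_abs]
      exact not_lt.1 fun hlt => hc l hlt
  have h0 : Real.exp (-2 * t * x ^ 2) ≤ Real.exp (-(a * t * x ^ 2)) := by
    refine Real.exp_le_exp.2 ?_
    have : a * (t * x ^ 2) ≤ 2 * (t * x ^ 2) := mul_le_mul_of_nonneg_right ha2 (by positivity)
    linarith
  calc _ ≤ P.real {ω | x < ‖L.emp (fun s : Fin t => X i s ω) - L.arm i‖} +
        ∑ l : Fin m, P.real {ω | x < |(t : ℝ)⁻¹ * ∑ s : Fin t, B (L.step (X i s ω)) l
          - B (L.arm i) l|} :=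
        (measureReal_mono hsub).trans ((measureReal_union_le _ _).trans
          (add_le_add_right (measureReal_iUnion_fintype_le _) _))
    _ ≤ 2 * Real.exp (-(a * t * x ^ 2)) + ∑ _l : Fin m, 2 * Real.exp (-(a * t * x ^ 2)) := by
        refine add_le_add ((L.real_lt_norm_le hX i ht hx).trans (by linarith))
          (Finset.sum_le_sum fun l _ => (h i l x hx t ht).trans (le_of_eq ?_))
        ring_nf
    _ = _ := by simp; ring

theorem concentrates_of_subGaussianWith [IsProbabilityMeasure P] [∀ i, IsProbabilityMeasure (ν i)]
    (hX : IsRewardModel P ν X) {a : ℝ} (ha2 : a ≤ 2) (h : L.SubGaussianWith B P X a) :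
    L.Concentrates P X (L.compNorm B) (a * (Real.log 2 / Real.log (2 * (m + 1)))) := by
  intro i x hx t ht
  set S := {ω | x ≤ L.compNorm B (L.emp (fun s : Fin t => X i s ω) - L.arm i)}
  have h1 : P.real S ≤ 2 * (m + 1) * Real.exp (-(a * t * x ^ 2)) := by
    -- The union bound controls strict exceedances of `y`. Letting `y` increase to `x` gives the
    -- non-strict one.
    have hc : Filter.Tendsto (fun y : ℝ => 2 * (m + 1) * Real.exp (-(a * t * y ^ 2)))
        (nhdsWithin x (Set.Iio x)) (nhds (2 * (m + 1) * Real.exp (-(a * t * x ^ 2)))) :=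
      (Continuous.tendsto (by fun_prop) x).mono_left nhdsWithin_le_nhds
    refine ge_of_tendsto hc ?_
    filter_upwards [Ioo_mem_nhdsLT hx] with y hy
    exact (measureReal_mono fun ω hω => hy.2.trans_le hω).trans
      (L.real_lt_compNorm_le B hX ha2 h i hy.1 ht)
  have h2 := min_one_mul_exp_le (c := 2 * (m + 1)) (y := a * t * x ^ 2)
    (by have : (0 : ℝ) ≤ m := m.cast_nonneg
        linarith)
  refine (le_min measureReal_le_one h1).trans (h2.trans (le_of_eq ?_))
  ring_nf

theorem subGaussian_const_pos {a : ℝ} (ha : 0 < a) (m : ℕ) :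
    0 < a * (Real.log 2 / Real.log (2 * (m + 1))) := by
  have : (0 : ℝ) ≤ m := m.cast_nonneg
  exact mul_pos ha (div_pos (Real.log_pos one_lt_two) (Real.log_pos (by linarith)))

theorem concentrates_of_subGaussian [IsProbabilityMeasure P] [∀ i, IsProbabilityMeasure (ν i)]
    (hX : IsRewardModel P ν X) (h : ∃ a : ℝ, 0 < a ∧ L.SubGaussianWith B P X a) :
    ∃ a : ℝ, 0 < a ∧ L.Concentrates P X (L.compNorm B) a := by
  obtain ⟨a, ha, h⟩ := h
  exact ⟨_, subGaussian_const_pos (lt_min ha two_pos) m,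
    L.concentrates_of_subGaussianWith B hX (min_le_right a 2) (h.mono (min_le_left a 2))⟩

theorem map_mem_hull {F : L.space} (hF : F ∈ L.mixSet) (M : ℝ) : B F ∈ L.hull B M :=
  subset_convexHull ℝ _ ⟨F, Or.inl hF, rfl⟩

theorem map_mem_hull_of_mem_empBall {F G : L.space} (hF : F ∈ L.mixSet) {M : ℝ}
    (hG : G ∈ L.empBall (L.compNorm B) M {F}) : B G ∈ L.hull B M := by
  obtain ⟨hG, F', rfl, h⟩ := hG
  exact subset_convexHull ℝ _ ⟨G, Or.inr ⟨hG, F', hF, h⟩, rfl⟩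

/-- A polynomial modulus of continuity of `h` at the values of `B` transfers to `h ∘ B`. -/
theorem hasModulus_of_forall {h : (Fin m → ℝ) → ℝ} {b q : ℝ} (hb : 0 ≤ b) (hq : 0 ≤ q)
    (H : ∀ F ∈ L.mixSet, ∀ G ∈ L.mixSet ∪ L.empSet,
      |h (B F) - h (B G)| ≤ b * (‖B F - B G‖ + ‖B F - B G‖ ^ q)) :
    L.HasModulus (L.compNorm B) (fun F => h (B F)) b q := by
  intro F hF G hG
  refine (H F hF G hG).trans (mul_le_mul_of_nonneg_left ?_ hb)
  have := L.norm_map_le_compNorm B (F - G)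
  rw [map_sub] at this
  exact add_le_add this (Real.rpow_le_rpow (norm_nonneg _) this hq)

theorem stronglyStableWith_of_polyModulus [IsProbabilityMeasure P]
    [∀ i, IsProbabilityMeasure (ν i)] (hX : IsRewardModel P ν X) {h : (Fin m → ℝ) → ℝ}
    {b q a : ℝ} (hh : L.PolyModulus B h b q) (ha : 0 < a) (ha2 : a ≤ 2)
    (hs : L.SubGaussianWith B P X a) :
    L.StronglyStableWith P X (L.compNorm B) (fun F => h (B F)) b q
      (a * (Real.log 2 / Real.log (2 * (m + 1)))) :=
  ⟨hh.1, hh.2.1, subGaussian_const_pos ha m,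
    L.hasModulus_of_forall B hh.1.le (zero_le_one.trans hh.2.1) fun F hF G _ =>
      hh.2.2 (B F) (L.map_mem_hull B hF 0) (B G),
    L.concentrates_of_subGaussianWith B hX ha2 hs⟩

end FunSpace

/-! ### Derivative bounds and Taylor's formula -/

section Calculus

variable {m : ℕ}

theorem abs_fderiv_apply_le (h : (Fin m → ℝ) → ℝ) (x v : Fin m → ℝ) :
    |fderiv ℝ h x v| ≤ gradNorm h x * ‖v‖ := by
  have hv : fderiv ℝ h x v = ∑ j, v j * fderiv ℝ h x (Pi.single j 1) := by
    conv_lhs => rw [pi_eq_sum_univ' v]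
    simp [map_sum]
  rw [hv, gradNorm, Finset.sum_mul]
  refine (Finset.abs_sum_le_sum_abs _ _).trans (Finset.sum_le_sum fun j _ => ?_)
  rw [abs_mul, mul_comm]
  exact mul_le_mul_of_nonneg_left (norm_le_pi_norm v j) (abs_nonneg _)

theorem sum_abs_mulVec_le (W : Matrix (Fin m) (Fin m) ℝ) (v : Fin m → ℝ) (hv : ‖v‖ ≤ 1) :
    ∑ i, |W.mulVec v i| ≤ ∑ i, ∑ j, |W i j| := by
  simp only [Matrix.mulVec, dotProduct]
  refine Finset.sum_le_sum fun i _ => (Finset.abs_sum_le_sum_abs _ _).trans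
    (Finset.sum_le_sum fun j _ => ?_)
  rw [abs_mul]
  exact mul_le_of_le_one_right (abs_nonneg _) ((norm_le_pi_norm v j).trans hv)

theorem normInfOne_le (W : Matrix (Fin m) (Fin m) ℝ) : normInfOne W ≤ ∑ i, ∑ j, |W i j| :=
  csSup_le ⟨_, 0, by simp, rfl⟩ (by rintro _ ⟨v, hv, rfl⟩; exact sum_abs_mulVec_le W v hv)

theorem le_normInfOne (W : Matrix (Fin m) (Fin m) ℝ) {v : Fin m → ℝ} (hv : ‖v‖ ≤ 1) :
    ∑ i, |W.mulVec v i| ≤ normInfOne W :=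
  le_csSup ⟨_, by rintro _ ⟨v, hv, rfl⟩; exact sum_abs_mulVec_le W v hv⟩ ⟨v, hv, rfl⟩

theorem normInfOne_nonneg (W : Matrix (Fin m) (Fin m) ℝ) : 0 ≤ normInfOne W :=
  (Finset.sum_nonneg fun _ _ => abs_nonneg _).trans (le_normInfOne W (v := 0) (by simp))

theorem sum_abs_mulVec_le_normInfOne_mul (W : Matrix (Fin m) (Fin m) ℝ) (v : Fin m → ℝ) :
    ∑ i, |W.mulVec v i| ≤ normInfOne W * ‖v‖ := by
  rcases eq_or_ne v 0 with rfl | hv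
  · simp
  have hv' : 0 < ‖v‖ := norm_pos_iff.2 hv
  have h := le_normInfOne W (v := ‖v‖⁻¹ • v) (by rw [norm_smul]; simp [hv'.ne'])
  simp only [Matrix.mulVec_smul, Pi.smul_apply, smul_eq_mul, abs_mul, ← Finset.mul_sum] at h
  rw [abs_of_pos (inv_pos.2 hv'), inv_mul_le_iff₀ hv'] at h
  linarith

/-- The quadratic form pairs `v`, measured in `ℓ^∞`, with the Hessian applied to `v`, measured in
the dual norm `ℓ¹`. -/
theorem abs_hessian_apply_le (h : (Fin m → ℝ) → ℝ) (x v : Fin m → ℝ) :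
    |fderiv ℝ (fderiv ℝ h) x v v| ≤ normInfOne (hessian h x) * ‖v‖ ^ 2 := by
  have hv : fderiv ℝ (fderiv ℝ h) x v v = ∑ i, v i * (hessian h x).mulVec v i := by
    conv_lhs => rw [pi_eq_sum_univ' v]
    simp only [map_sum, _root_.sum_apply, map_smul, _root_.smul_apply,
      smul_eq_mul, Matrix.mulVec, dotProduct, hessian, Matrix.of_apply, Finset.mul_sum]
    rw [Finset.sum_comm]
    exact Finset.sum_congr rfl fun i _ => Finset.sum_congr rfl fun j _ => by ring
  rw [hv]
  calc |∑ i, v i * (hessian h x).mulVec v i|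
      ≤ ∑ i, ‖v‖ * |(hessian h x).mulVec v i| := by
        refine (Finset.abs_sum_le_sum_abs _ _).trans (Finset.sum_le_sum fun i _ => ?_)
        rw [abs_mul]
        exact mul_le_mul_of_nonneg_right (norm_le_pi_norm v i) (abs_nonneg _)
    _ ≤ ‖v‖ * (normInfOne (hessian h x) * ‖v‖) := by
        rw [← Finset.mul_sum]
        exact mul_le_mul_of_nonneg_left (sum_abs_mulVec_le_normInfOne_mul _ _) (norm_nonneg _)
    _ = _ := by ring

/-- Kept one-sided: the two-sided Taylor bound follows by applying it to `g` and to `-g`. -/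
theorem sub_sub_le_of_deriv2_le {g g' g'' : ℝ → ℝ} {D : ℝ}
    (h1 : ∀ s ∈ Set.Icc (0 : ℝ) 1, HasDerivAt g (g' s) s)
    (h2 : ∀ s ∈ Set.Icc (0 : ℝ) 1, HasDerivAt g' (g'' s) s)
    (hD : ∀ s ∈ Set.Icc (0 : ℝ) 1, g'' s ≤ D) : g 1 - g 0 - g' 0 ≤ 1 / 2 * D := by
  have k2 : ∀ s ∈ Set.Icc (0 : ℝ) 1, HasDerivAt (fun s => g' s - D * s) (g'' s - D) s :=
    fun s hs => by simpa using (h2 s hs).fun_sub ((hasDerivAt_id' s).const_mul D)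
  have k1 : ∀ s ∈ Set.Icc (0 : ℝ) 1,
      HasDerivAt (fun s => g s - g' 0 * s - D * (s ^ 2 / 2)) (g' s - g' 0 - D * s) s := by
    intro s hs
    have := ((hasDerivAt_pow 2 s).div_const 2).const_mul D
    refine (((h1 s hs).sub ((hasDerivAt_id' s).const_mul (g' 0))).sub this).congr_deriv ?_
    simp
  have a2 : AntitoneOn (fun s => g' s - D * s) (Set.Icc 0 1) := by
    refine antitoneOn_of_deriv_nonpos (convex_Icc 0 1)
      (fun s hs => (k2 s hs).continuousAt.continuousWithinAt)
      (fun s hs => (k2 s (interior_subset hs)).differentiableAt.differentiableWithinAt) ?_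
    intro s hs
    rw [(k2 s (interior_subset hs)).deriv]
    linarith [hD s (interior_subset hs)]
  have a1 : AntitoneOn (fun s => g s - g' 0 * s - D * (s ^ 2 / 2)) (Set.Icc 0 1) := by
    refine antitoneOn_of_deriv_nonpos (convex_Icc 0 1)
      (fun s hs => (k1 s hs).continuousAt.continuousWithinAt)
      (fun s hs => (k1 s (interior_subset hs)).differentiableAt.differentiableWithinAt) ?_
    intro s hs
    have hs' := interior_subset hs
    rw [(k1 s hs').deriv]
    have := a2 ⟨le_rfl, zero_le_one⟩ hs' hs'.1
    simp only [mul_zero, sub_zero] at this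
    linarith
  have := a1 ⟨le_rfl, zero_le_one⟩ ⟨zero_le_one, le_rfl⟩ zero_le_one
  simp only at this
  linarith

/-- Taylor's formula of order two on a convex set. -/
theorem abs_sub_sub_fderiv_le {E : Type*} [NormedAddCommGroup E] [NormedSpace ℝ E] {h : E → ℝ}
    {U S : Set E} (hU : IsOpen U) (hh : ContDiffOn ℝ 2 h U) (hS : Convex ℝ S) (hSU : S ⊆ U)
    {x y : E} (hx : x ∈ S) (hy : y ∈ S) {D : ℝ}
    (hD : ∀ z ∈ S, |fderiv ℝ (fderiv ℝ h) z (y - x) (y - x)| ≤ D) :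
    |h y - h x - fderiv ℝ h x (y - x)| ≤ 1 / 2 * D := by
  set l : ℝ → E := fun s => x + s • (y - x)
  have hl : ∀ s ∈ Set.Icc (0 : ℝ) 1, l s ∈ S := fun s hs => hS.add_smul_sub_mem hx hy hs
  have hld : ∀ s, HasDerivAt l (y - x) s := fun s => by
    simpa [l] using ((hasDerivAt_id' s).smul_const (y - x)).const_add x
  have hat : ∀ z ∈ S, ContDiffAt ℝ 2 h z := fun z hz => hh.contDiffAt (hU.mem_nhds (hSU hz))
  have d1 : ∀ s ∈ Set.Icc (0 : ℝ) 1,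
      HasDerivAt (fun s => h (l s)) (fderiv ℝ h (l s) (y - x)) s := fun s hs =>
    ((hat _ (hl s hs)).differentiableAt (by norm_num)).hasFDerivAt.comp_hasDerivAt s (hld s)
  have d2 : ∀ s ∈ Set.Icc (0 : ℝ) 1, HasDerivAt (fun s => fderiv ℝ h (l s) (y - x))
      (fderiv ℝ (fderiv ℝ h) (l s) (y - x) (y - x)) s := fun s hs => by
    have h1 : ContDiffAt ℝ 1 (fderiv ℝ h) (l s) :=
      (hat _ (hl s hs)).fderiv_right (by norm_num)
    have h2 := (h1.differentiableAt (by norm_num)).hasFDerivAt.comp_hasDerivAt s (hld s)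
    simpa using h2.clm_apply (hasDerivAt_const s (y - x))
  have u1 := sub_sub_le_of_deriv2_le d1 d2 fun s hs => (abs_le.1 (hD _ (hl s hs))).2
  have u2 := sub_sub_le_of_deriv2_le (fun s hs => (d1 s hs).neg) (fun s hs => (d2 s hs).neg)
    fun s hs => neg_le.1 (abs_le.1 (hD _ (hl s hs))).1
  simp only [l, one_smul, zero_smul, add_zero, add_sub_cancel, Pi.neg_apply] at u1 u2
  exact abs_le.2 ⟨by linarith, u1⟩

/-- A one-sided modulus of continuity along rays bounds the derivative. -/
theorem abs_fderiv_apply_le_of_modulus {E : Type*} [NormedAddCommGroup E] [NormedSpace ℝ E]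
    {h : E → ℝ} {x : E} (hd : DifferentiableAt ℝ h x) {b q : ℝ} (hq : 1 ≤ q)
    (hm : ∀ y, |h x - h y| ≤ b * (‖x - y‖ + ‖x - y‖ ^ q)) (v : E) :
    |fderiv ℝ h x v| ≤ b * (‖v‖ + (if q = 1 then ‖v‖ else 0)) := by
  have h1 : HasDerivAt (fun s : ℝ => h (x + s • v)) (fderiv ℝ h x v) 0 := by
    have h2 : HasDerivAt (fun s : ℝ => x + s • v) v 0 := by
      simpa using ((hasDerivAt_id' (0 : ℝ)).smul_const v).const_add x
    have h3 : HasFDerivAt h (fderiv ℝ h x) (x + (0 : ℝ) • v) := by simpa using hd.hasFDerivAt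
    exact h3.comp_hasDerivAt 0 h2
  have h4 := h1.tendsto_slope_zero_right.abs
  -- The modulus bounds the difference quotient at `s` by this expression. As `s → 0` the second
  -- term vanishes if `q > 1` and equals `‖v‖` if `q = 1`, whence the constants `b` and `2 b`.
  have h5 : Filter.Tendsto (fun s : ℝ => b * (‖v‖ + s ^ (q - 1) * ‖v‖ ^ q))
      (nhdsWithin 0 (Set.Ioi 0)) (nhds (b * (‖v‖ + (if q = 1 then ‖v‖ else 0)))) := by
    refine (tendsto_const_nhds.add ?_).const_mul b
    split_ifs with hq1
    · subst hq1
      simp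
    · have hq' : 0 < q - 1 := sub_pos.2 (lt_of_le_of_ne hq (Ne.symm hq1))
      have := ((Real.continuousAt_rpow_const 0 (q - 1) (Or.inr hq'.le)).tendsto.mul_const
        (‖v‖ ^ q)).mono_left (nhdsWithin_le_nhds (s := Set.Ioi 0))
      rwa [Real.zero_rpow hq'.ne', zero_mul] at this
  refine le_of_tendsto_of_tendsto h4 h5 ?_
  filter_upwards [self_mem_nhdsWithin] with s hs
  have hs : 0 < s := hs
  have h6 := hm (x + s • v)
  rw [sub_add_cancel_left, norm_neg, norm_smul, Real.norm_of_nonneg hs.le,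
    Real.mul_rpow hs.le (norm_nonneg v), abs_sub_comm] at h6
  simp only [zero_add, zero_smul, add_zero, smul_eq_mul]
  rw [abs_mul, abs_of_pos (inv_pos.2 hs), inv_mul_le_iff₀ hs]
  refine h6.trans (le_of_eq ?_)
  have : s ^ q = s * s ^ (q - 1) := by
    rw [← Real.rpow_one_add' hs.le (by linarith)]; congr 1; ring
  rw [this]
  ring

theorem continuousOn_gradNorm_and_hessian {U : Set (Fin m → ℝ)} (hU : IsOpen U) {h : (Fin m → ℝ) → ℝ}
    (hh : ContDiffOn ℝ 2 h U) :
    ContinuousOn (gradNorm h) U ∧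
      ContinuousOn (fun x => ∑ i, ∑ j, |hessian h x i j|) U := by
  have h1 : ContDiffOn ℝ 1 (fderiv ℝ h) U := hh.fderiv_of_isOpen hU (by norm_num)
  have h2 : ContinuousOn (fderiv ℝ (fderiv ℝ h)) U :=
    h1.continuousOn_fderiv_of_isOpen hU le_rfl
  refine ⟨continuousOn_finsetSum _ fun j _ =>
    (h1.continuousOn.clm_apply continuousOn_const).abs, ?_⟩
  exact continuousOn_finsetSum _ fun i _ => continuousOn_finsetSum _ fun j _ =>
    ((h2.clm_apply continuousOn_const).clm_apply continuousOn_const).abs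

end Calculus

/-! ### Geometry of the hull, and smoothness -/

namespace FunSpace

variable {K : ℕ} {ν : Fin K → Measure ℝ} (L : FunSpace ν) {m : ℕ}
  (B : L.space →ₗ[ℝ] (Fin m → ℝ))

/-- The value of `B` at a mixture of arms, as a linear function of the weights. -/
def mixMap : (Fin K → ℝ) →ₗ[ℝ] (Fin m → ℝ) :=
  ∑ i, (LinearMap.proj i : (Fin K → ℝ) →ₗ[ℝ] ℝ).smulRight (B (L.arm i))

theorem image_mixSet : B '' L.mixSet = L.mixMap B '' stdSimplex ℝ (Fin K) := by
  ext z
  constructor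
  · rintro ⟨_, ⟨p, hp, rfl⟩, rfl⟩
    exact ⟨p, hp, by simp [mixMap]⟩
  · rintro ⟨p, hp, rfl⟩
    exact ⟨_, ⟨p, hp, rfl⟩, by simp [mixMap]⟩

theorem isCompact_image_mixSet : IsCompact (B '' L.mixSet) := by
  rw [image_mixSet]
  exact (isCompact_stdSimplex _ _).image (LinearMap.continuous_of_finiteDimensional _)

theorem convex_image_mixSet : Convex ℝ (B '' L.mixSet) := by
  rw [image_mixSet]
  exact (convex_stdSimplex ℝ _).linear_image _

theorem arm_mem_mixSet (i : Fin K) : L.arm i ∈ L.mixSet :=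
  ⟨Pi.single i 1, single_mem_stdSimplex ℝ i, by simp [Pi.single_apply]⟩

/-- At radius 0 the empirical distributions add nothing, because the norm dominates the sup norm and
is therefore definite. The image of the mixtures is already convex. -/
theorem hull_zero : L.hull B 0 = B '' L.mixSet := by
  have h : L.empBall (L.compNorm B) 0 L.mixSet ⊆ L.mixSet := by
    rintro f ⟨_, F, hF, h⟩
    have h1 := (L.norm_le_compNorm B (F - f)).trans h
    rw [← sub_eq_zero.1 (norm_le_zero_iff.1 h1)]
    exact hF
  rw [hull, Set.union_eq_left.2 h, (L.convex_image_mixSet B).convexHull_eq]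

theorem hull_mono {M M' : ℝ} (h : M ≤ M') : L.hull B M ⊆ L.hull B M' :=
  convexHull_mono (Set.image_mono (Set.union_subset_union_right _
    fun _ ⟨hf, F, hF, hM⟩ => ⟨hf, F, hF, hM.trans h⟩))

theorem isBounded_hull (M : ℝ) : Bornology.IsBounded (L.hull B M) := by
  refine isBounded_convexHull.2 ((L.isCompact_image_mixSet B).isBounded.cthickening (δ := M)
    |>.subset ?_)
  rintro _ ⟨f, hf | ⟨_, F, hF, h⟩, rfl⟩
  · exact Metric.self_subset_cthickening _ ⟨f, hf, rfl⟩
  · refine Metric.mem_cthickening_of_dist_le _ (B F) _ _ ⟨F, hF, rfl⟩ ?_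
    rw [dist_comm, dist_eq_norm, ← map_sub]
    exact (L.norm_map_le_compNorm B _).trans h

theorem isCompact_closure_hull (M : ℝ) : IsCompact (closure (L.hull B M)) :=
  (L.isBounded_hull B M).isCompact_closure

/-- The segment from `B F` to `B G` stays in the hull by convexity, so a Hessian bound there
suffices. The derivative bound is a separate hypothesis, so that it may come either from the
gradient norm or from a modulus of continuity. -/
theorem smoothWith_of_le {h : (Fin m → ℝ) → ℝ} {U : Set (Fin m → ℝ)} (hU : IsOpen U)
    (hh : ContDiffOn ℝ 2 h U) {M₀ d₁ d₂ : ℝ} (hM : 0 < M₀) (hsub : L.hull B M₀ ⊆ U)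
    (h1 : 0 ≤ d₁) (h2 : 0 ≤ d₂) (hd₁ : ∀ x ∈ L.hull B 0, ∀ v, |fderiv ℝ h x v| ≤ d₁ * ‖v‖)
    (hd₂ : ∀ x ∈ L.hull B M₀, normInfOne (hessian h x) ≤ d₂) :
    L.SmoothWith (L.compNorm B) (fun F => h (B F)) d₁ d₂ M₀ := by
  refine ⟨h1, h2, hM, fun F => (fderiv ℝ h (B F)).toLinearMap ∘ₗ B, fun F => ?_, fun F hF => ?_⟩
  · refine ⟨‖fderiv ℝ h (B F)‖, fun f => ?_⟩
    exact ((fderiv ℝ h (B F)).le_opNorm (B f)).trans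
      (mul_le_mul_of_nonneg_left (L.norm_map_le_compNorm B f) (norm_nonneg _))
  · refine ⟨fun G _ => ?_, fun G hG => ?_⟩
    · exact (hd₁ _ (L.map_mem_hull B hF 0) _).trans
        (mul_le_mul_of_nonneg_left (L.norm_map_le_compNorm B _) h1)
    · have hG' : B G ∈ L.hull B M₀ := by
        rcases hG with hG | hG
        · exact L.map_mem_hull B hG M₀
        · exact L.map_mem_hull_of_mem_empBall B hF hG
      have ht := abs_sub_sub_fderiv_le hU hh (convex_convexHull ℝ _) hsub
        (L.map_mem_hull B hF M₀) hG' (D := d₂ * L.compNorm B (G - F) ^ 2) fun z hz => by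
          refine (abs_hessian_apply_le h z _).trans ?_
          refine mul_le_mul (hd₂ z hz) ?_ (by positivity) h2
          rw [← map_sub]
          exact pow_le_pow_left₀ (norm_nonneg _) (L.norm_map_le_compNorm B _) 2
      simp only [LinearMap.comp_apply, ContinuousLinearMap.coe_coe, map_sub B]
      rw [mul_assoc]
      exact ht

theorem exists_smoothWith (hK : 0 < K) {h : (Fin m → ℝ) → ℝ} {M₀ : ℝ} (hM : 0 < M₀)
    (hC : L.C2Near B h M₀) :
    ∃ d₁ d₂ : ℝ,
      IsGreatest (gradNorm h '' L.hull B 0) d₁ ∧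
      IsLUB ((fun x => normInfOne (hessian h x)) '' L.hull B M₀) d₂ ∧
      L.SmoothWith (L.compNorm B) (fun F => h (B F)) d₁ d₂ M₀ ∧
      ∀ b q : ℝ, L.PolyModulus B h b q →
        (1 < q → L.SmoothWith (L.compNorm B) (fun F => h (B F)) b d₂ M₀) ∧
        (q = 1 → L.SmoothWith (L.compNorm B) (fun F => h (B F)) (2 * b) d₂ M₀) := by
  obtain ⟨ε, hε, hh⟩ := hC
  set U := Metric.thickening ε (L.hull B M₀)
  have hU : IsOpen U := Metric.isOpen_thickening
  have hcl : closure (L.hull B M₀) ⊆ U := Metric.closure_subset_thickening hε _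
  have hsub : L.hull B M₀ ⊆ U := subset_closure.trans hcl
  have h0 : L.hull B 0 ⊆ L.hull B M₀ := L.hull_mono B hM.le
  obtain ⟨hg, hH⟩ := continuousOn_gradNorm_and_hessian hU hh
  have hne : (L.hull B 0).Nonempty := ⟨_, L.map_mem_hull B (L.arm_mem_mixSet ⟨0, hK⟩) 0⟩
  have hc0 : IsCompact (L.hull B 0) := by
    rw [hull_zero]
    exact L.isCompact_image_mixSet B
  obtain ⟨d₁, hd₁⟩ := (hc0.image_of_continuousOn
    (hg.mono (h0.trans hsub))).exists_isGreatest (hne.image _)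
  -- The sum of the absolute values of the Hessian entries dominates `normInfOne` and is continuous,
  -- hence bounded on the compact closure of the hull.
  obtain ⟨C, hC⟩ := ((L.isCompact_closure_hull B M₀).image_of_continuousOn
    (hH.mono hcl)).bddAbove
  have hbdd : BddAbove ((fun x => normInfOne (hessian h x)) '' L.hull B M₀) := by
    refine ⟨C, ?_⟩
    rintro _ ⟨x, hx, rfl⟩
    exact (normInfOne_le _).trans (hC ⟨x, subset_closure hx, rfl⟩)
  have hd₂ := isLUB_csSup ((hne.mono h0).image _) hbdd
  set d₂ := sSup ((fun x => normInfOne (hessian h x)) '' L.hull B M₀)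
  have hd₂' : ∀ x ∈ L.hull B M₀, normInfOne (hessian h x) ≤ d₂ := fun x hx =>
    hd₂.1 ⟨x, hx, rfl⟩
  obtain ⟨x₀, hx₀⟩ := hne
  have hd₂0 : 0 ≤ d₂ := (normInfOne_nonneg _).trans (hd₂' x₀ (h0 hx₀))
  have hd₁' : ∀ x ∈ L.hull B 0, gradNorm h x ≤ d₁ := fun x hx => hd₁.2 ⟨x, hx, rfl⟩
  have hd₁0 : 0 ≤ d₁ := (Finset.sum_nonneg fun _ _ => abs_nonneg _).trans (hd₁' x₀ hx₀)
  have hdiff : ∀ x ∈ L.hull B 0, DifferentiableAt ℝ h x := fun x hx =>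
    (hh.contDiffAt (hU.mem_nhds (hsub (h0 hx)))).differentiableAt (by norm_num)
  refine ⟨d₁, d₂, hd₁, hd₂, ?_, fun b q hp => ⟨fun hq => ?_, fun hq => ?_⟩⟩
  · exact L.smoothWith_of_le B hU hh hM hsub hd₁0 hd₂0 (fun x hx v =>
      (abs_fderiv_apply_le h x v).trans
        (mul_le_mul_of_nonneg_right (hd₁' x hx) (norm_nonneg v))) hd₂'
  · refine L.smoothWith_of_le B hU hh hM hsub hp.1.le hd₂0 (fun x hx v => ?_) hd₂'
    have := abs_fderiv_apply_le_of_modulus (hdiff x hx) hp.2.1 (hp.2.2 x hx) v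
    rwa [if_neg hq.ne', add_zero] at this
  · refine L.smoothWith_of_le B hU hh hM hsub (by linarith [hp.1]) hd₂0 (fun x hx v => ?_) hd₂'
    have := abs_fderiv_apply_le_of_modulus (hdiff x hx) hp.2.1 (hp.2.2 x hx) v
    rw [if_pos hq] at this
    linarith

end FunSpace

/-! ### The examples -/

theorem stepFun_eq_cdfFun (x : ℝ) : stepFun x = cdfFun (Measure.dirac x) := by
  ext y
  change (Set.Ici x).indicator (fun _ => (1 : ℝ)) y = cdf (Measure.dirac x) y
  rw [cdf_eq_real, measureReal_def, Measure.dirac_apply' _ measurableSet_Iic]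
  by_cases h : x ≤ y <;> simp [Set.indicator, h]

theorem sq_integral_le {μ : Measure ℝ} [IsProbabilityMeasure μ] (h1 : Integrable (fun x => x) μ)
    (h2 : Integrable (fun x => x ^ 2) μ) : (∫ x, x ∂μ) ^ 2 ≤ ∫ x, x ^ 2 ∂μ := by
  set c := ∫ x, x ∂μ
  have h3 : 0 ≤ ∫ x, (x ^ 2 - 2 * c * x + c ^ 2) ∂μ :=
    integral_nonneg fun x => by
      change 0 ≤ x ^ 2 - 2 * c * x + c ^ 2
      nlinarith [sq_nonneg (x - c)]
  have h4 : Integrable (fun x => x ^ 2 - 2 * c * x) μ := h2.sub (h1.const_mul _)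
  rw [integral_add h4 (integrable_const _), integral_sub h2 (h1.const_mul _), integral_const_mul, integral_const] at h3
  simp only [probReal_univ, one_smul] at h3
  change 0 ≤ _ - 2 * c * c + c ^ 2 at h3
  linarith

/-- Deliberately asymmetric: `|α|` appears as a factor and `|β|` does not, because only the mixture
is known to have bounded moments. -/
theorem abs_div_sqrt_sub_div_sqrt_le {ε u w α β : ℝ} (hε : 0 < ε) (hu : ε ≤ u) (hw : ε ≤ w) :
    |α / Real.sqrt u - β / Real.sqrt w|
      ≤ |α - β| / Real.sqrt ε + |α| * (|u - w| / Real.sqrt ε ^ 3) := by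
  set s := Real.sqrt ε
  set a := Real.sqrt u
  set c := Real.sqrt w
  have hs : 0 < s := Real.sqrt_pos.2 hε
  have hsa : s ≤ a := Real.sqrt_le_sqrt hu
  have hsc : s ≤ c := Real.sqrt_le_sqrt hw
  have ha : 0 < a := hs.trans_le hsa
  have hc : 0 < c := hs.trans_le hsc
  have hua : u = a ^ 2 := (Real.sq_sqrt (hε.le.trans hu)).symm
  have hwc : w = c ^ 2 := (Real.sq_sqrt (hε.le.trans hw)).symm
  have e : α / a - β / c = (α - β) / c + α * ((w - u) / ((a + c) * a * c)) := by
    rw [hua, hwc]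
    field_simp
    ring
  rw [e]
  refine (abs_add_le _ _).trans (add_le_add ?_ ?_)
  · rw [abs_div, abs_of_pos hc]
    exact div_le_div_of_nonneg_left (abs_nonneg _) hs hsc
  · rw [abs_mul, abs_div, abs_sub_comm w u, abs_of_pos (by positivity : 0 < (a + c) * a * c)]
    refine mul_le_mul_of_nonneg_left (div_le_div_of_nonneg_left (abs_nonneg _) (by positivity) ?_)
      (abs_nonneg _)
    calc s ^ 3 = s * s * s := by ring
      _ ≤ (a + c) * a * c := by
        gcongr
        linarith

namespace FunSpace

variable {Ω : Type*} [MeasurableSpace Ω] {P : Measure Ω} {K : ℕ} {ν : Fin K → Measure ℝ}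
  {X : Fin K → ℕ → Ω → ℝ} (L : FunSpace ν) {m : ℕ} (B : L.space →ₗ[ℝ] (Fin m → ℝ))

/-- A step function is the distribution function of a Dirac mass, against which integration is
evaluation. -/
theorem IsMomentMap.map_step {L : FunSpace ν} {B : L.space →ₗ[ℝ] (Fin m → ℝ)}
    {φ : Fin m → ℝ → ℝ} (h : L.IsMomentMap B φ) (x : ℝ) (l : Fin m) : B (L.step x) l = φ l x := by
  rw [(h (L.step x) (Measure.dirac x) inferInstance (stepFun_eq_cdfFun x) l).2, integral_dirac]

theorem map_mem_of_mem_mixSet {C : Set (Fin m → ℝ)} (hC : Convex ℝ C)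
    (harm : ∀ i, B (L.arm i) ∈ C) {F : L.space} (hF : F ∈ L.mixSet) : B F ∈ C := by
  obtain ⟨p, hp, rfl⟩ := hF
  rw [map_sum]
  simp_rw [map_smul]
  exact hC.sum_mem (fun i _ => hp.1 i) hp.2 fun i _ => harm i

theorem map_mem_of_mem_empSet {C : Set (Fin m → ℝ)} (hC : Convex ℝ C)
    (hstep : ∀ x, B (L.step x) ∈ C) {F : L.space} (hF : F ∈ L.empSet) : B F ∈ C := by
  obtain ⟨t, ht, x, rfl⟩ := hF
  have ht' : (t : ℝ) ≠ 0 := by positivity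
  rw [map_emp, Finset.smul_sum]
  exact hC.sum_mem (fun _ _ => by positivity) (by simp [ht']) fun s _ => hstep (x s)

theorem hull_subset {C : Set (Fin m → ℝ)} (hC : Convex ℝ C) (harm : ∀ i, B (L.arm i) ∈ C)
    (hstep : ∀ x, B (L.step x) ∈ C) (M : ℝ) : L.hull B M ⊆ C := by
  refine convexHull_min ?_ hC
  rintro _ ⟨F, hF | hF, rfl⟩
  · exact L.map_mem_of_mem_mixSet B hC harm hF
  · exact L.map_mem_of_mem_empSet B hC hstep hF.1

theorem c2Near_of_hull_subset {h : (Fin m → ℝ) → ℝ} {C U : Set (Fin m → ℝ)} {M : ℝ}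
    (hM : L.hull B M ⊆ C) (hC : IsClosed C) (hCU : C ⊆ U) (hU : IsOpen U)
    (hh : ContDiffOn ℝ 2 h U) : L.C2Near B h M := by
  obtain ⟨ε, hε, hsub⟩ := (L.isCompact_closure_hull B M).exists_thickening_subset_open hU
    ((closure_minimal hM hC).trans hCU)
  exact ⟨ε, hε, hh.mono ((Metric.thickening_subset_of_subset ε subset_closure).trans hsub)⟩

/-- A locally uniform quadratic modulus of continuity on a convex set containing the values of `B`
gives strong stability. -/
theorem stronglyStable_of_convex [IsProbabilityMeasure P] [∀ i, IsProbabilityMeasure (ν i)]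
    (hX : IsRewardModel P ν X) {h : (Fin m → ℝ) → ℝ} {C : Set (Fin m → ℝ)} (hC : Convex ℝ C)
    (harm : ∀ i, B (L.arm i) ∈ C) (hstep : ∀ x, B (L.step x) ∈ C)
    (hh : ∀ R, 0 ≤ R → ∃ b, 0 < b ∧ ∀ x ∈ C, ‖x‖ ≤ R → ∀ y ∈ C,
      |h x - h y| ≤ b * (‖x - y‖ + ‖x - y‖ ^ 2))
    (hs : ∃ a : ℝ, 0 < a ∧ L.SubGaussianWith B P X a) :
    L.StronglyStable P X (L.compNorm B) (fun F => h (B F)) := by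
  obtain ⟨a, ha, hconc⟩ := L.concentrates_of_subGaussian B hX hs
  -- Values at mixtures are bounded, while values at empirical distributions may be arbitrarily far
  -- away. Both lie in `C`, so the modulus is needed only there; off `C` a ratio such as `sharpe`
  -- can blow up.
  obtain ⟨R, hR, hbd⟩ := (L.isCompact_image_mixSet B).isBounded.exists_pos_norm_le
  obtain ⟨b, hb, hmod⟩ := hh R hR.le
  refine ⟨b, 2, a, hb, one_le_two, ha, ?_, hconc⟩
  refine L.hasModulus_of_forall B hb.le zero_le_two fun F hF G hG => ?_
  rw [Real.rpow_two]
  refine hmod _ (L.map_mem_of_mem_mixSet B hC harm hF) (hbd _ ⟨F, hF, rfl⟩) _ ?_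
  rcases hG with hG | hG
  · exact L.map_mem_of_mem_mixSet B hC harm hG
  · exact L.map_mem_of_mem_empSet B hC hstep hG

theorem exists_smoothWith_of_c2Near (hK : 0 < K) {h : (Fin m → ℝ) → ℝ} {M₀ : ℝ} (hM : 0 < M₀)
    (hC : L.C2Near B h M₀) :
    ∃ d₁ d₂ : ℝ, L.SmoothWith (L.compNorm B) (fun F => h (B F)) d₁ d₂ M₀ := by
  obtain ⟨d₁, d₂, _, _, h, _⟩ := L.exists_smoothWith B hK hM hC
  exact ⟨d₁, d₂, h⟩

end FunSpace

theorem abs_sub_apply_le {m : ℕ} (x y : Fin m → ℝ) (i : Fin m) : |x i - y i| ≤ ‖x - y‖ :=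
  norm_le_pi_norm (x - y) i

/-- Expanding around `x` requires a bound on `x` alone and leaves a quadratic remainder, which
accounts for the exponent 2 in the modulus. -/
theorem abs_sq_sub_sq_le {m : ℕ} {x : Fin m → ℝ} {R : ℝ} (hx : ‖x‖ ≤ R) (y : Fin m → ℝ)
    (i : Fin m) : |x i ^ 2 - y i ^ 2| ≤ 2 * R * ‖x - y‖ + ‖x - y‖ ^ 2 := by
  have h1 := abs_sub_apply_le x y i
  have h2 : |x i| ≤ R := (norm_le_pi_norm x i).trans hx
  have e : x i ^ 2 - y i ^ 2 = (x i - y i) * (2 * x i) - (x i - y i) ^ 2 := by ring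
  rw [e]
  refine (abs_sub _ _).trans ?_
  rw [abs_mul, abs_mul, abs_two, abs_pow]
  have h3 : |x i - y i| * (2 * |x i|) ≤ ‖x - y‖ * (2 * R) := by gcongr
  have h4 : |x i - y i| ^ 2 ≤ ‖x - y‖ ^ 2 := by gcongr
  linarith

theorem meanVariance_modulus {ρ R : ℝ} (hρ : 0 ≤ ρ) (hR : 0 ≤ R) {x : Fin 2 → ℝ} (hx : ‖x‖ ≤ R)
    (y : Fin 2 → ℝ) : |meanVariance ρ x - meanVariance ρ y|
      ≤ (1 + 2 * ρ + 2 * ρ * R) * (‖x - y‖ + ‖x - y‖ ^ 2) := by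
  have e : meanVariance ρ x - meanVariance ρ y
      = (x 0 - y 0) - ρ * (x 1 - y 1) + ρ * (x 0 ^ 2 - y 0 ^ 2) := by
    simp only [meanVariance]; ring
  have h0 := abs_sub_apply_le x y 0
  have h1 := mul_le_mul_of_nonneg_left (abs_sub_apply_le x y 1) hρ
  have h2 := mul_le_mul_of_nonneg_left (abs_sq_sub_sq_le hx y 0) hρ
  have h3 := abs_add_le ((x 0 - y 0) - ρ * (x 1 - y 1)) (ρ * (x 0 ^ 2 - y 0 ^ 2))
  have h4 := abs_sub (x 0 - y 0) (ρ * (x 1 - y 1))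
  rw [abs_mul, abs_of_nonneg hρ] at h3 h4
  rw [e]
  set d := ‖x - y‖
  have hd : 0 ≤ d := norm_nonneg _
  have := mul_nonneg hρ hd
  have := mul_nonneg hρ (sq_nonneg d)
  have := mul_nonneg (mul_nonneg hρ hR) (sq_nonneg d)
  have := sq_nonneg d
  linarith

/-- The set of pairs of first and second moments. -/
def momentSet : Set (Fin 2 → ℝ) := {x | x 0 ^ 2 ≤ x 1}

theorem convex_momentSet : Convex ℝ momentSet := by
  intro x hx y hy a b ha hb hab
  simp only [momentSet, Set.mem_ofPred_eq, Pi.add_apply, Pi.smul_apply, smul_eq_mul] at *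
  have h1 := mul_le_mul_of_nonneg_left hx ha
  have h2 := mul_le_mul_of_nonneg_left hy hb
  have h3 : (a * x 0 + b * y 0) ^ 2
      = a * x 0 ^ 2 + b * y 0 ^ 2 - a * b * (x 0 - y 0) ^ 2 := by
    have : b = 1 - a := by linarith
    subst this; ring
  have := mul_nonneg (mul_nonneg ha hb) (sq_nonneg (x 0 - y 0))
  linarith

theorem isClosed_momentSet : IsClosed momentSet :=
  isClosed_le (by fun_prop) (by fun_prop)

theorem sharpe_modulus {r ε R : ℝ} (hε : 0 < ε) (hR : 0 ≤ R) {x y : Fin 2 → ℝ}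
    (hx : x ∈ momentSet) (hxR : ‖x‖ ≤ R) (hy : y ∈ momentSet) :
    |sharpe r ε x - sharpe r ε y|
      ≤ (1 / Real.sqrt ε + (R + |r|) * ((1 + 2 * R) / Real.sqrt ε ^ 3))
        * (‖x - y‖ + ‖x - y‖ ^ 2) := by
  have hs : 0 < Real.sqrt ε := Real.sqrt_pos.2 hε
  have hx' : x 0 ^ 2 ≤ x 1 := hx
  have hy' : y 0 ^ 2 ≤ y 1 := hy
  have h := abs_div_sqrt_sub_div_sqrt_le (ε := ε) (u := ε + (x 1 - x 0 ^ 2))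
    (w := ε + (y 1 - y 0 ^ 2)) (α := x 0 - r) (β := y 0 - r) hε (by linarith) (by linarith)
  refine h.trans ?_
  set d := ‖x - y‖
  have hd : 0 ≤ d := norm_nonneg _
  have h1 : |x 0 - r - (y 0 - r)| ≤ d + d ^ 2 := by
    rw [sub_sub_sub_cancel_right]
    have := abs_sub_apply_le x y 0
    nlinarith
  have h2 : |x 0 - r| ≤ R + |r| :=
    (abs_sub _ _).trans (add_le_add_left ((norm_le_pi_norm x 0).trans hxR) _)
  have h3 : |ε + (x 1 - x 0 ^ 2) - (ε + (y 1 - y 0 ^ 2))| ≤ (1 + 2 * R) * (d + d ^ 2) := by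
    have e : ε + (x 1 - x 0 ^ 2) - (ε + (y 1 - y 0 ^ 2))
        = (x 1 - y 1) - (x 0 ^ 2 - y 0 ^ 2) := by ring
    rw [e]
    have a1 := abs_sub (x 1 - y 1) (x 0 ^ 2 - y 0 ^ 2)
    have a2 := abs_sub_apply_le x y 1
    have a3 := abs_sq_sub_sq_le hxR y 0
    have := mul_nonneg hR (sq_nonneg d)
    linarith
  calc _ ≤ (d + d ^ 2) / Real.sqrt ε
        + (R + |r|) * ((1 + 2 * R) * (d + d ^ 2) / Real.sqrt ε ^ 3) := by gcongr
    _ = _ := by ring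

theorem sortino_modulus {r ε R : ℝ} (hε : 0 < ε) (hR : 0 ≤ R) {x y : Fin 2 → ℝ}
    (hx : x 1 ≤ 0) (hxR : ‖x‖ ≤ R) (hy : y 1 ≤ 0) :
    |sortino r ε x - sortino r ε y|
      ≤ (1 / Real.sqrt ε + (R + |r|) * (1 / Real.sqrt ε ^ 3)) * (‖x - y‖ + ‖x - y‖ ^ 2) := by
  have hs : 0 < Real.sqrt ε := Real.sqrt_pos.2 hε
  have h := abs_div_sqrt_sub_div_sqrt_le (ε := ε) (u := ε - x 1)
    (w := ε - y 1) (α := x 0 - r) (β := y 0 - r) hε (by linarith) (by linarith)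
  refine h.trans ?_
  set d := ‖x - y‖
  have hd : 0 ≤ d := norm_nonneg _
  have h1 : |x 0 - r - (y 0 - r)| ≤ d + d ^ 2 := by
    rw [sub_sub_sub_cancel_right]
    have := abs_sub_apply_le x y 0
    nlinarith
  have h2 : |x 0 - r| ≤ R + |r| :=
    (abs_sub _ _).trans (add_le_add_left ((norm_le_pi_norm x 0).trans hxR) _)
  have h3 : |ε - x 1 - (ε - y 1)| ≤ d + d ^ 2 := by
    rw [sub_sub_sub_cancel_left, abs_sub_comm]
    have := abs_sub_apply_le x y 1
    nlinarith
  calc _ ≤ (d + d ^ 2) / Real.sqrt ε + (R + |r|) * ((d + d ^ 2) / Real.sqrt ε ^ 3) := by gcongr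
    _ = _ := by ring

theorem contDiff_coord {m : ℕ} (i : Fin m) : ContDiff ℝ 2 fun x : Fin m → ℝ => x i :=
  contDiff_apply ℝ ℝ i

theorem contDiff_meanVariance (ρ : ℝ) : ContDiff ℝ 2 (meanVariance ρ) :=
  (contDiff_coord 0).sub (contDiff_const.mul ((contDiff_coord 1).sub ((contDiff_coord 0).pow 2)))

theorem contDiffOn_sharpe (r ε : ℝ) :
    ContDiffOn ℝ 2 (sharpe r ε) {x | 0 < ε + (x 1 - x 0 ^ 2)} := by
  refine ContDiffOn.div ((contDiff_coord 0).sub contDiff_const).contDiffOn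
    (ContDiffOn.sqrt (contDiff_const.add
      ((contDiff_coord 1).sub ((contDiff_coord 0).pow 2))).contDiffOn
      fun _ hx => ne_of_gt hx) fun _ hx => (Real.sqrt_pos.2 hx).ne'

theorem contDiffOn_sortino (r ε : ℝ) : ContDiffOn ℝ 2 (sortino r ε) {x | 0 < ε - x 1} := by
  refine ContDiffOn.div ((contDiff_coord 0).sub contDiff_const).contDiffOn
    (ContDiffOn.sqrt (contDiff_const.sub (contDiff_coord 1)).contDiffOn
      fun _ hx => ne_of_gt hx) fun _ hx => (Real.sqrt_pos.2 hx).ne'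

theorem contDiffOn_entropic (θ : ℝ) : ContDiffOn ℝ 2 (entropic θ) {x | 0 < x 0} :=
  contDiffOn_const.mul ((contDiff_coord 0).contDiffOn.log fun _ hx => ne_of_gt hx)

namespace FunSpace

variable {K : ℕ} {ν : Fin K → Measure ℝ} [∀ i, IsProbabilityMeasure (ν i)] {L : FunSpace ν}

theorem IsMomentMap.map_arm {m : ℕ} {B : L.space →ₗ[ℝ] (Fin m → ℝ)} {φ : Fin m → ℝ → ℝ}
    (h : L.IsMomentMap B φ) (i : Fin K) (l : Fin m) :
    Integrable (φ l) (ν i) ∧ B (L.arm i) l = ∫ x, φ l x ∂(ν i) :=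
  h (L.arm i) (ν i) inferInstance rfl l

variable {B : L.space →ₗ[ℝ] (Fin 2 → ℝ)}

theorem IsMomentMap.arm_mem_momentSet (h : L.IsMomentMap B momentsTwo) (i : Fin K) :
    B (L.arm i) ∈ momentSet := by
  obtain ⟨h0, e0⟩ := h.map_arm i 0
  obtain ⟨h1, e1⟩ := h.map_arm i 1
  change B (L.arm i) 0 ^ 2 ≤ B (L.arm i) 1
  rw [e0, e1]
  exact sq_integral_le h0 h1

omit [∀ i, IsProbabilityMeasure (ν i)] in
theorem IsMomentMap.step_mem_momentSet (h : L.IsMomentMap B momentsTwo) (x : ℝ) :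
    B (L.step x) ∈ momentSet := by
  change B (L.step x) 0 ^ 2 ≤ B (L.step x) 1
  rw [h.map_step, h.map_step]
  exact le_refl (x ^ 2)

theorem momentsTarget_one_nonpos (r x : ℝ) : momentsTarget r 1 x ≤ 0 := by
  change (if x ≤ r then -(x - r) ^ 2 else 0) ≤ 0
  split_ifs
  · nlinarith [sq_nonneg (x - r)]
  · exact le_rfl

theorem IsMomentMap.arm_target_nonpos {r : ℝ} (h : L.IsMomentMap B (momentsTarget r))
    (i : Fin K) : B (L.arm i) 1 ≤ 0 := by
  rw [(h.map_arm i 1).2]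
  exact integral_nonpos fun x => momentsTarget_one_nonpos r x

omit [∀ i, IsProbabilityMeasure (ν i)] in
theorem IsMomentMap.step_target_nonpos {r : ℝ} (h : L.IsMomentMap B (momentsTarget r))
    (x : ℝ) : B (L.step x) 1 ≤ 0 := by
  rw [h.map_step]
  exact momentsTarget_one_nonpos r x

theorem convex_setOf_coord_nonpos : Convex ℝ {x : Fin 2 → ℝ | x 1 ≤ 0} :=
  convex_halfSpace_le (f := fun x : Fin 2 → ℝ => x 1)
    (LinearMap.proj (R := ℝ) (φ := fun _ : Fin 2 => ℝ) 1).isLinear 0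

theorem convex_setOf_le_coord (c : ℝ) : Convex ℝ {x : Fin 1 → ℝ | c ≤ x 0} :=
  convex_halfSpace_ge (f := fun x : Fin 1 → ℝ => x 0)
    (LinearMap.proj (R := ℝ) (φ := fun _ : Fin 1 => ℝ) 0).isLinear c

-- Used for entropic risk. Exponential moments of empirical distributions come arbitrarily close to
-- 0, where the logarithm is singular. Within distance `M` of a mixture, however, the coordinate
-- falls at most `M` below that of the mixture.
omit [∀ i, IsProbabilityMeasure (ν i)] in
theorem hull_subset_setOf_le_coord {B : L.space →ₗ[ℝ] (Fin 1 → ℝ)} {M δ : ℝ} (hM : 0 ≤ M)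
    (harm : ∀ i, M + δ ≤ B (L.arm i) 0) : L.hull B M ⊆ {x | δ ≤ x 0} := by
  have hmix : ∀ F ∈ L.mixSet, M + δ ≤ B F 0 := fun F hF =>
    L.map_mem_of_mem_mixSet B (convex_setOf_le_coord (M + δ)) harm hF
  refine convexHull_min ?_ (convex_setOf_le_coord δ)
  rintro _ ⟨f, hf | ⟨_, F, hF, h⟩, rfl⟩
  · have := hmix f hf
    change δ ≤ B f 0
    linarith
  · have h1 := hmix F hF
    have h2 := abs_sub_apply_le (B F) (B f) 0
    rw [← map_sub] at h2
    have h3 := (abs_le.1 (h2.trans ((L.norm_map_le_compNorm B _).trans h))).2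
    change δ ≤ B f 0
    linarith

end FunSpace

end EDPM

end

theorem mainTheorem12 {Ω : Type*} [MeasurableSpace Ω] (P : Measure Ω) [IsProbabilityMeasure P]
    {K : ℕ} (hK : 0 < K) (ν : Fin K → Measure ℝ) [∀ i, IsProbabilityMeasure (ν i)]
    (X : Fin K → ℕ → Ω → ℝ) (hX : EDPM.IsRewardModel P ν X) (L : EDPM.FunSpace ν) :
    -- strong stability
    (∀ (m : ℕ) (B : L.space →ₗ[ℝ] (Fin m → ℝ)) (h : (Fin m → ℝ) → ℝ) (b q a : ℝ),
      L.PolyModulus B h b q → 0 < a → a ≤ 2 → L.SubGaussianWith B P X a →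
      L.StronglyStableWith P X (L.compNorm B) (fun F => h (B F)) b q
        (a * (Real.log 2 / Real.log (2 * (m + 1))))) ∧
    -- smoothness
    (∀ (m : ℕ) (B : L.space →ₗ[ℝ] (Fin m → ℝ)) (h : (Fin m → ℝ) → ℝ) (M₀ : ℝ),
      0 < M₀ → L.C2Near B h M₀ →
      ∃ d₁ d₂ : ℝ,
        IsGreatest (EDPM.gradNorm h '' L.hull B 0) d₁ ∧
        IsLUB ((fun x => EDPM.normInfOne (EDPM.hessian h x)) '' L.hull B M₀) d₂ ∧
        L.SmoothWith (L.compNorm B) (fun F => h (B F)) d₁ d₂ M₀ ∧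
        ∀ b q : ℝ, L.PolyModulus B h b q →
          (1 < q → L.SmoothWith (L.compNorm B) (fun F => h (B F)) b d₂ M₀) ∧
          (q = 1 → L.SmoothWith (L.compNorm B) (fun F => h (B F)) (2 * b) d₂ M₀)) ∧
    -- mean-variance
    (∀ B : L.space →ₗ[ℝ] (Fin 2 → ℝ), L.IsMomentMap B EDPM.momentsTwo → ∀ ρ : ℝ, 0 ≤ ρ →
      ((∃ a : ℝ, 0 < a ∧ L.SubGaussianWith B P X a) →
        L.StronglyStable P X (L.compNorm B) (fun F => EDPM.meanVariance ρ (B F))) ∧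
      ∀ M₀ : ℝ, 0 < M₀ → ∃ d₁ d₂ : ℝ,
        L.SmoothWith (L.compNorm B) (fun F => EDPM.meanVariance ρ (B F)) d₁ d₂ M₀) ∧
    -- Sharpe ratio
    (∀ B : L.space →ₗ[ℝ] (Fin 2 → ℝ), L.IsMomentMap B EDPM.momentsTwo → ∀ r ε : ℝ, 0 < ε →
      ((∃ a : ℝ, 0 < a ∧ L.SubGaussianWith B P X a) →
        L.StronglyStable P X (L.compNorm B) (fun F => EDPM.sharpe r ε (B F))) ∧
      ∀ M₀ : ℝ, 0 < M₀ → ∃ d₁ d₂ : ℝ,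
        L.SmoothWith (L.compNorm B) (fun F => EDPM.sharpe r ε (B F)) d₁ d₂ M₀) ∧
    -- Sortino ratio
    (∀ r : ℝ, ∀ B : L.space →ₗ[ℝ] (Fin 2 → ℝ), L.IsMomentMap B (EDPM.momentsTarget r) →
      ∀ ε : ℝ, 0 < ε →
      ((∃ a : ℝ, 0 < a ∧ L.SubGaussianWith B P X a) →
        L.StronglyStable P X (L.compNorm B) (fun F => EDPM.sortino r ε (B F))) ∧
      ∀ M₀ : ℝ, 0 < M₀ → ∃ d₁ d₂ : ℝ,
        L.SmoothWith (L.compNorm B) (fun F => EDPM.sortino r ε (B F)) d₁ d₂ M₀) ∧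
    -- entropic risk
    (∀ θ : ℝ, 0 < θ → ∀ B : L.space →ₗ[ℝ] (Fin 1 → ℝ), L.IsMomentMap B (EDPM.momentsExp θ) →
      ((∃ a : ℝ, 0 < a ∧ L.SubGaussianWith B P X a) →
        ∃ a : ℝ, 0 < a ∧ L.Concentrates P X (L.compNorm B) a) ∧
      ∀ M₀ : ℝ, 0 < M₀ → (∀ i, M₀ < ∫ x, Real.exp (-θ * x) ∂(ν i)) → ∃ d₁ d₂ : ℝ,
        L.SmoothWith (L.compNorm B) (fun F => EDPM.entropic θ (B F)) d₁ d₂ M₀) := by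

  refine ⟨fun m B h b q a hh ha ha2 hs =>
      L.stronglyStableWith_of_polyModulus B hX hh ha ha2 hs,
    fun m B h M₀ hM hC => L.exists_smoothWith B hK hM hC, ?_, ?_, ?_, ?_⟩
  · refine fun B _ ρ hρ => ⟨fun hs => ?_, fun M₀ hM => ?_⟩
    · refine L.stronglyStable_of_convex B hX convex_univ (fun _ => trivial) (fun _ => trivial)
        (fun R hR => ⟨1 + 2 * ρ + 2 * ρ * R, by positivity, fun x _ hx y _ =>
          EDPM.meanVariance_modulus hρ hR hx y⟩) hs
    · exact L.exists_smoothWith_of_c2Near B hK hM (L.c2Near_of_hull_subset B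
        (Set.subset_univ _) isClosed_univ subset_rfl isOpen_univ
        (EDPM.contDiff_meanVariance ρ).contDiffOn)
  · refine fun B hB r ε hε => ⟨fun hs => ?_, fun M₀ hM => ?_⟩
    · refine L.stronglyStable_of_convex B hX EDPM.convex_momentSet hB.arm_mem_momentSet
        hB.step_mem_momentSet (fun R hR => ⟨_, ?_, fun x hx hxR y hy =>
          EDPM.sharpe_modulus hε hR hx hxR hy⟩) hs
      have := Real.sqrt_pos.2 hε
      positivity
    · refine L.exists_smoothWith_of_c2Near B hK hM (L.c2Near_of_hull_subset B
        (L.hull_subset B EDPM.convex_momentSet hB.arm_mem_momentSet hB.step_mem_momentSet M₀)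
        EDPM.isClosed_momentSet ?_ (isOpen_lt (by fun_prop) (by fun_prop))
        (EDPM.contDiffOn_sharpe r ε))
      intro x hx
      have hx' : x 0 ^ 2 ≤ x 1 := hx
      change 0 < ε + (x 1 - x 0 ^ 2)
      linarith
  · refine fun r B hB ε hε => ⟨fun hs => ?_, fun M₀ hM => ?_⟩
    · refine L.stronglyStable_of_convex B hX EDPM.FunSpace.convex_setOf_coord_nonpos
        hB.arm_target_nonpos hB.step_target_nonpos (fun R hR => ⟨_, ?_, fun x hx hxR y hy =>
          EDPM.sortino_modulus hε hR hx hxR hy⟩) hs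
      have := Real.sqrt_pos.2 hε
      positivity
    · refine L.exists_smoothWith_of_c2Near B hK hM (L.c2Near_of_hull_subset B
        (L.hull_subset B EDPM.FunSpace.convex_setOf_coord_nonpos hB.arm_target_nonpos
          hB.step_target_nonpos M₀)
        (isClosed_le (by fun_prop) (by fun_prop)) ?_ (isOpen_lt (by fun_prop) (by fun_prop))
        (EDPM.contDiffOn_sortino r ε))
      intro x hx
      have hx' : x 1 ≤ 0 := hx
      change 0 < ε - x 1
      linarith
  · refine fun θ _ B hB => ⟨L.concentrates_of_subGaussian B hX, fun M₀ hM hlt => ?_⟩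
    have : Nonempty (Fin K) := ⟨⟨0, hK⟩⟩
    -- The gap between the smallest exponential moment of an arm and `M₀` keeps the whole hull
    -- uniformly away from 0.
    obtain ⟨j, hj⟩ := Finite.exists_min fun i => B (L.arm i) 0
    have hpos : 0 < B (L.arm j) 0 - M₀ := by
      rw [(hB.map_arm j 0).2]
      exact sub_pos.2 (hlt j)
    refine L.exists_smoothWith_of_c2Near B hK hM (L.c2Near_of_hull_subset B
      (EDPM.FunSpace.hull_subset_setOf_le_coord (δ := B (L.arm j) 0 - M₀) hM.le
        fun i => ?_)
      (isClosed_le continuous_const (continuous_apply 0)) (fun x hx => hpos.trans_le hx)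
      (isOpen_lt continuous_const (continuous_apply 0)) (EDPM.contDiffOn_entropic θ))
    rw [add_sub_cancel]
    exact hj i
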